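/- Let $k,m\le n$ be non-negative integers, let $B\subset \mathrm{GL}_n(\mathbb C)$ be the group of invertible upper triangular matrices, and let $e_1,\dots,e_n$ be the standard basis of $\mathbb C^n$. Let $\lambda=(\lambda_1\ge\dots\ge\lambda_k\ge 0)$ and $\mu=(\mu_1\ge\dots\ge\mu_m\ge 0)$ be Young diagrams with $\lambda_1\le n-k$ and $\mu_1\le n-m$. Put $s_i(\lambda)=1$ if $i\in\{\lambda_k+1,\lambda_{k-1}+2,\dots,\lambda_1+k\}$ and $s_i(\lambda)=0$ otherwise; define $s_i(\mu)$ in the same way, with $m$ in place of $k$, and put $s_i(\lambda,\mu)=s_i(\lambda)+s_i(\mu)$ for $1\le i\le n$. Let $U_\lambda=\langle e_i\mid s_i(\lambda)=1\rangle\in\mathrm{Gr}(k,n)$ and $U_\mu=\langle e_i\mid s_i(\mu)=1\rangle\in\mathrm{Gr}(m,n)$, and let $X^\circ_\lambda=B\cdot U_\lambda$ and $X^\circ_\mu=B\cdot U_\mu$ be the Schubert cells. Let $\mathcal I_n=\{w\in S_n\mid w^2=\mathrm{id}\}$, and let $\mathcal I_n(\lambda,\mu)\subseteq\mathcal I_n$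 be the set of $(\lambda,\mu)$-consistent involutions: those $w\in\mathcal I_n$ such that $s_i(\lambda,\mu)=0$ and $s_j(\lambda,\mu)=2$ whenever $i<j$, $w(i)=j$ and $w(j)=i$. For $w\in\mathcal I_n(\lambda,\mu)$ let $\mathcal O^w_{\lambda\mu}\subset\mathrm{Gr}(k,n)\times\mathrm{Gr}(m,n)$ be the orbit of the pair $(U,U_\mu)$ under the diagonal action of $B$, where $$U=\langle e_j\mid s_j(\lambda)=1,\ w(j)=j\rangle+\langle e_{w(j)}+e_j\mid s_j(\lambda)=1,\ w(j)\ne j\rangle .$$ For $w\in\mathcal I_n$ let $w_<$ be the strictly upper triangular matrix of square zero with $(w_<)_{ij}=1$ if $w(i)=j$ and $i<j$, and $(w_<)_{ij}=0$ otherwise. Let $B\cdot w_<$ be its orbit under conjugation by $B$ in the variety of strictly upper triangular $n\times n$ complex matrices with square zero. Melnikov's (adjoint) order on $\mathcal I_n$ is defined by: $v\le w$ if and only if $B\cdot v_<\subseteq\overline{B\cdot w_<}$. All closures are taken in the Zariski topology. Then: 1. The map $w\mapsto\mathcal O^w_{\lambda\mu}$ is a bijection from $\mathcal I_n(\lambda,\mu)$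 onto the set of $B$-orbits contained in the $(B\times B)$-orbit $X^\circ_\lambda\times X^\circ_\mu\subset\mathrm{Gr}(k,n)\times\mathrm{Gr}(m,n)$. 2. The relation $v\le w$ on $\mathcal I_n$ and the relation $\mathcal O^v_{\lambda\mu}\subseteq\overline{\mathcal O^w_{\lambda\mu}}$ on $\mathcal I_n(\lambda,\mu)$ (closure in $\mathrm{Gr}(k,n)\times\mathrm{Gr}(m,n)$) are partial orders. 3. The second order is the restriction of the first: for all $v,w\in\mathcal I_n(\lambda,\mu)$, $\mathcal O^v_{\lambda\mu}\subseteq\overline{\mathcal O^w_{\lambda\mu}}$ if and only if $B\cdot v_<\subseteq\overline{B\cdot w_<}$. -/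

import Mathlib

open scoped Matrix Topology

noncomputable section

namespace DoubleGrassmannian

/-! ### The Zariski topology -/

/-- The Zariski topology on the affine space `σ → ℂ`: the closed sets are the common zero loci of
ideals of polynomials. -/
abbrev zariski (σ : Type) : TopologicalSpace (σ → ℂ) :=
  TopologicalSpace.ofClosed
    {Z | ∃ I : Ideal (MvPolynomial σ ℂ), Z = MvPolynomial.zeroLocus ℂ I}
    ⟨⊤, by simp⟩
    (by
      intro A hA
      refine ⟨sSup {I | MvPolynomial.zeroLocus ℂ I ∈ A}, ?_⟩
      apply Set.Subset.antisymm
      · intro x hx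
        have h : sSup {I : Ideal (MvPolynomial σ ℂ) | MvPolynomial.zeroLocus ℂ I ∈ A} ≤
            MvPolynomial.vanishingIdeal ℂ {x} :=
          sSup_le fun I hI => MvPolynomial.le_zeroLocus_iff_le_vanishingIdeal.1
            (Set.singleton_subset_iff.2 (hx _ hI))
        exact MvPolynomial.le_zeroLocus_iff_le_vanishingIdeal.2 h rfl
      · intro x hx Z hZ
        obtain ⟨I, rfl⟩ := hA hZ
        exact MvPolynomial.zeroLocus_anti_mono (le_sSup hZ) hx)
    (by
      rintro _ ⟨I, rfl⟩ _ ⟨J, rfl⟩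
      refine ⟨I * J, ?_⟩
      ext x
      simp only [Set.mem_union, MvPolynomial.mem_zeroLocus_iff]
      constructor
      · rintro (h | h) p hp
        · exact h p ((Ideal.mul_le_left : I * J ≤ I) hp)
        · exact h p ((Ideal.mul_le_right : I * J ≤ J) hp)
      · intro h
        by_contra! hc
        obtain ⟨⟨p, hp, hp0⟩, q, hq, hq0⟩ := hc
        have := h _ (Ideal.mul_mem_mul hp hq)
        rw [map_mul] at this
        exact mul_ne_zero hp0 hq0 this)

/-! ### The Borel subgroup and involutions -/

/-- The subgroup `B` of upper triangular matrices in `GL n`. -/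
def borel (n : ℕ) : Subgroup (GL (Fin n) ℂ) where
  carrier := {g | ∀ i j, j < i → (g : Matrix (Fin n) (Fin n) ℂ) i j = 0}
  one_mem' := by
    intro i j h
    simp [h.ne']
  mul_mem' := by
    intro a b ha hb
    have ha' : (a : Matrix (Fin n) (Fin n) ℂ).BlockTriangular id := fun i j h => ha i j h
    have hb' : (b : Matrix (Fin n) (Fin n) ℂ).BlockTriangular id := fun i j h => hb i j h
    exact fun i j h => (ha'.mul hb') h
  inv_mem' := by
    intro a ha i j h
    have ha' : (a : Matrix (Fin n) (Fin n) ℂ).BlockTriangular id := fun i j h => ha i j h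
    have : Invertible (a : Matrix (Fin n) (Fin n) ℂ) := a.invertible
    rw [Matrix.coe_units_inv]
    exact Matrix.blockTriangular_inv_of_blockTriangular ha' h

/-- The set of involutive permutations (the identity included). -/
def involutions (n : ℕ) : Set (Equiv.Perm (Fin n)) := {w | w ^ 2 = 1}

/-! ### Strictly upper triangular matrices with square zero -/

/-- The variety of strictly upper triangular `n × n` matrices with square zero. -/
def SqZeroUpper (n : ℕ) : Type :=
  {X : Matrix (Fin n) (Fin n) ℂ // (∀ i j, j ≤ i → X i j = 0) ∧ X * X = 0}

/-- Its Zariski topology, as a subspace of the affine space of matrices. -/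
instance (n : ℕ) : TopologicalSpace (SqZeroUpper n) :=
  TopologicalSpace.induced (fun X (p : Fin n × Fin n) => X.1 p.1 p.2) (zariski (Fin n × Fin n))

/-- The matrix `w_<`: the strictly upper triangular part of the permutation matrix of `w`. -/
def upperPart {n : ℕ} (w : involutions n) : SqZeroUpper n :=
  ⟨Matrix.of fun i j => if w.1 i = j ∧ i < j then 1 else 0, by
    refine ⟨fun i j h => by simp [h.not_gt], ?_⟩
    ext i j
    rw [Matrix.mul_apply]
    refine Finset.sum_eq_zero fun l _ => ?_
    have hw : w.1 (w.1 i) = i := by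
      have h := w.2
      simp only [involutions, Set.mem_ofPred_eq, sq] at h
      simpa using congrArg (fun f => f i) h
    simp only [Matrix.of_apply]
    split_ifs with h1 h2
    · obtain ⟨rfl, h1⟩ := h1
      obtain ⟨rfl, h2⟩ := h2
      rw [hw] at h2
      exact absurd h2 h1.not_gt
    all_goals simp⟩

/-- The orbit `B · w_<` under conjugation. -/
def adjointOrbit {n : ℕ} (w : involutions n) : Set (SqZeroUpper n) :=
  {X | ∃ g ∈ borel n, X.1 = (g : Matrix (Fin n) (Fin n) ℂ) * (upperPart w).1 *
    ((g⁻¹ : GL (Fin n) ℂ) : Matrix (Fin n) (Fin n) ℂ)}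

/-- The adjoint order on involutions: `v ≤ w` if and only if `B · v_<` is contained in the closure
of `B · w_<`. -/
def adjointLE {n : ℕ} (v w : involutions n) : Prop :=
  adjointOrbit v ⊆ closure (adjointOrbit w)

/-! ### Grassmannians -/

/-- The Grassmannian of `k`-dimensional subspaces of `ℂⁿ`. -/
def Gr (k n : ℕ) : Type := {U : Submodule ℂ (Fin n → ℂ) // Module.finrank ℂ U = k}

/-- `GL n` acts on the Grassmannian by taking images of subspaces. -/
instance (k n : ℕ) : MulAction (GL (Fin n) ℂ) (Gr k n) where
  smul g U := ⟨U.1.map (Matrix.toLin' (g : Matrix (Fin n) (Fin n) ℂ)), by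
    have hinj : Function.Injective (Matrix.toLin' (g : Matrix (Fin n) (Fin n) ℂ)) := by
      intro x y hxy
      exact Matrix.mulVec_injective_of_isUnit g.isUnit (by simpa using hxy)
    exact (LinearEquiv.finrank_eq (U.1.equivMapOfInjective _ hinj)).symm.trans U.2⟩
  one_smul U := Subtype.ext (by
    change U.1.map (Matrix.toLin' ((1 : GL (Fin n) ℂ) : Matrix (Fin n) (Fin n) ℂ)) = U.1
    simp)
  mul_smul g h U := Subtype.ext (by
    change U.1.map (Matrix.toLin' ((g * h : GL (Fin n) ℂ) : Matrix (Fin n) (Fin n) ℂ)) =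
      (U.1.map (Matrix.toLin' (h : Matrix (Fin n) (Fin n) ℂ))).map
        (Matrix.toLin' (g : Matrix (Fin n) (Fin n) ℂ))
    rw [Units.val_mul, Matrix.toLin'_mul, Submodule.map_comp])

/-- The `n × k` matrices of rank `k`. -/
def Frame (k n : ℕ) : Type :=
  {M : Matrix (Fin n) (Fin k) ℂ // LinearIndependent ℂ M.col}

/-- The column space of a full rank matrix. -/
def Frame.span {k n : ℕ} (M : Frame k n) : Gr k n :=
  ⟨Submodule.span ℂ (Set.range M.1.col), by simpa using finrank_span_eq_card M.2⟩

/-- The Zariski topology on pairs of full rank matrices, as a subspace of affine space. -/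
abbrev frameTopology (k m n : ℕ) : TopologicalSpace (Frame k n × Frame m n) :=
  TopologicalSpace.induced
    (fun F => Sum.elim (fun p : Fin n × Fin k => F.1.1 p.1 p.2)
      (fun p : Fin n × Fin m => F.2.1 p.1 p.2))
    (zariski ((Fin n × Fin k) ⊕ (Fin n × Fin m)))

/-- The Zariski topology on the variety `Gr(k,n) × Gr(m,n)`, as the quotient of the variety of pairs
of full rank matrices by the change of bases. This is finer than the product of the Zariski
topologies of the two factors. -/
abbrev grTopology (k m n : ℕ) : TopologicalSpace (Gr k n × Gr m n) :=
  TopologicalSpace.coinduced (fun F => (F.1.span, F.2.span)) (frameTopology k m n)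

/-! ### Young diagrams, Schubert cells and consistent involutions -/

/-- The Young diagram `lam` is contained in the rectangle with `k` rows and `n - k` columns,
where `k ≤ n`. -/
def Fits (k n : ℕ) (lam : YoungDiagram) : Prop :=
  k ≤ n ∧ ∀ c ∈ lam.cells, c.1 < k ∧ c.2 < n - k

/-- The bit string `s(lam)`: it is `1` exactly at the positions `lam_k + 1`, `lam_{k-1} + 2`, …,
`lam_1 + k`. Rows of diagrams and positions are counted from `0` here. -/
def bit (k n : ℕ) (lam : YoungDiagram) (i : Fin n) : ℕ :=
  if ∃ a : Fin k, lam.rowLen (a.rev : ℕ) + (a : ℕ) = (i : ℕ) then 1 else 0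

/-- The componentwise sum `s(lam, mu)` of the two bit strings. -/
def bitSum (k m n : ℕ) (lam mu : YoungDiagram) (i : Fin n) : ℕ := bit k n lam i + bit m n mu i

/-- The `(lam, mu)`-consistent involutions. -/
def consistent (k m n : ℕ) (lam mu : YoungDiagram) : Set (Equiv.Perm (Fin n)) :=
  {w | w ∈ involutions n ∧ ∀ i j, i < j → w i = j → w j = i →
    bitSum k m n lam mu i = 0 ∧ bitSum k m n lam mu j = 2}

/-- The standard basis vector `e_i` of `ℂⁿ`. -/
def stdVec {n : ℕ} (i : Fin n) : Fin n → ℂ := Pi.single i 1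

theorem ncard_bit {k n : ℕ} {lam : YoungDiagram} (h : Fits k n lam) :
    {j : Fin n | bit k n lam j = 1}.ncard = k := by
  have hrow : ∀ i, lam.rowLen i ≤ n - k := by
    intro i
    by_contra! hc
    have := (h.2 (i, n - k) (YoungDiagram.mem_iff_lt_rowLen.2 hc)).2
    exact absurd this (lt_irrefl _)
  let f : Fin k → Fin n := fun a => ⟨lam.rowLen (a.rev : ℕ) + a, by
    have h1 := hrow (a.rev : ℕ)
    have h2 := a.2
    have h3 := h.1
    omega⟩
  have hf : Function.Injective f := by
    apply StrictMono.injective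
    intro a b hab
    have h1 : ((b.rev : Fin k) : ℕ) ≤ (a.rev : Fin k) := by
      have := Fin.rev_le_rev.2 hab.le
      exact this
    have h2 := lam.rowLen_anti _ _ h1
    have h3 : (a : ℕ) < b := hab
    change lam.rowLen (a.rev : ℕ) + a < lam.rowLen (b.rev : ℕ) + b
    omega
  have hs : {j : Fin n | bit k n lam j = 1} = Set.range f := by
    ext j
    simp [bit, f, Fin.ext_iff]
  rw [hs, ← Set.image_univ, Set.ncard_image_of_injective _ hf, Set.ncard_univ]
  simp

theorem finrank_span_of_dual {n : ℕ} (S : Set (Fin n)) (f : Fin n → Fin n → ℂ)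
    (hf : ∀ i ∈ S, ∀ j ∈ S, f i j = if i = j then 1 else 0) :
    Module.finrank ℂ (Submodule.span ℂ (f '' S)) = S.ncard := by
  classical
  have hli : LinearIndependent ℂ (fun i : S => f i) := by
    rw [Fintype.linearIndependent_iff]
    intro g hg j
    have := congrFun hg j
    simpa [Finset.sum_apply, hf _ (Subtype.prop _) _ j.2, ← Subtype.ext_iff] using this
  rw [Set.image_eq_range, finrank_span_eq_card hli, Set.ncard_eq_toFinset_card']
  simp

/-- The coordinate subspace `U_lam`, spanned by the `e_j` with `s_j(lam) = 1`. -/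
def coordPoint {k n : ℕ} {lam : YoungDiagram} (h : Fits k n lam) : Gr k n :=
  ⟨Submodule.span ℂ (stdVec '' {j | bit k n lam j = 1}), by
    rw [finrank_span_of_dual, ncard_bit h]
    intro i _ j _
    simp [stdVec, Pi.single_apply, eq_comm]⟩

/-- The Schubert cell of `lam`, the `B`-orbit of `U_lam`. -/
def schubertCell {k n : ℕ} {lam : YoungDiagram} (h : Fits k n lam) : Set (Gr k n) :=
  MulAction.orbit (borel n) (coordPoint h)

/-- The vector `e_j` if `j` is fixed by `w`, and `e_{w(j)} + e_j` otherwise. -/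
def arcVec {n : ℕ} (w : Equiv.Perm (Fin n)) (j : Fin n) : Fin n → ℂ :=
  if w j = j then stdVec j else stdVec (w j) + stdVec j

theorem arcVec_dual {k m n : ℕ} {lam mu : YoungDiagram} {w : Equiv.Perm (Fin n)}
    (hw : w ∈ consistent k m n lam mu) (i : Fin n) (hi : bit k n lam i = 1) (j : Fin n)
    (hj : bit k n lam j = 1) : arcVec w i j = if i = j then 1 else 0 := by
  unfold arcVec
  split_ifs with h1 h2 h2
  · simp [stdVec, h2]
  · simp [stdVec, Ne.symm h2]
  · subst h2
    simp [stdVec, Ne.symm h1]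
  · have hww : w (w i) = i := by
      have h := hw.1
      simp only [involutions, Set.mem_ofPred_eq, sq] at h
      simpa using congrArg (fun f => f i) h
    have hne : j ≠ w i := by
      rintro rfl
      rcases lt_or_gt_of_ne h1 with hlt | hlt
      · have := (hw.2 _ _ hlt hww rfl).1
        simp only [bitSum] at this
        omega
      · have := (hw.2 _ _ hlt rfl hww).1
        simp only [bitSum] at this
        omega
    simp [stdVec, Ne.symm h2, hne]

/-- The canonical pair of subspaces `(U, W)` attached to a consistent involution `w`: `U` is spanned
by the `e_j` with `s_j(lam) = 1` and `w(j) = j` and by the `e_{w(j)} + e_j` with `s_j(lam) = 1` and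
`w(j) ≠ j`, and `W = U_mu`. -/
def canonicalPair {k m n : ℕ} {lam mu : YoungDiagram} (hlam : Fits k n lam) (hmu : Fits m n mu)
    (w : consistent k m n lam mu) : Gr k n × Gr m n :=
  (⟨Submodule.span ℂ (arcVec w.1 '' {j | bit k n lam j = 1}), by
    rw [finrank_span_of_dual, ncard_bit hlam]
    exact fun i hi j hj => arcVec_dual w.2 i hi j hj⟩,
   coordPoint hmu)

/-- The orbit of the canonical pair of `w` under `B`, acting diagonally. -/
def pairOrbit {k m n : ℕ} {lam mu : YoungDiagram} (hlam : Fits k n lam) (hmu : Fits m n mu)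
    (w : consistent k m n lam mu) : Set (Gr k n × Gr m n) :=
  MulAction.orbit (borel n) (canonicalPair hlam hmu w)

/-- The relation on consistent involutions given by inclusion of `B`-orbit closures in
`Gr(k,n) × Gr(m,n)`. -/
def pairLE {k m n : ℕ} {lam mu : YoungDiagram} (hlam : Fits k n lam) (hmu : Fits m n mu)
    (v w : consistent k m n lam mu) : Prop :=
  pairOrbit hlam hmu v ⊆ closure[grTopology k m n] (pairOrbit hlam hmu w)

/-- A consistent involution, seen as an involution. -/
def toInvolution {k m n : ℕ} {lam mu : YoungDiagram} (w : consistent k m n lam mu) :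
    involutions n := ⟨w.1, w.2.1⟩

end DoubleGrassmannian

end

/-! Write `L`, `M` for the sets of ones of the two bit strings, `I = (L ∪ M)ᶜ`, `J = L ∩ M`, and
`P_S` for the coordinate projection onto `S`. Consistency of `w` says that all arcs lead from `I` to
`J`, and the canonical pair is `((1 + w_<) U_L, U_M)`. So both sides of the theorem concern matrices
supported in the block `I × J`.

Normal form. Every pair in the product of cells can be moved by `B` to `(b U_L, U_M)` with `b ∈ B`.
Its `B`-orbit depends on `b` only through the block `C = P_{Mᶜ} b P_L`. The square subblock of `C`
on `L \ M` is triangular and invertible; eliminating it leaves the Schur complement `X = C - C K C`,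
which lives in `I × J`, is strictly upper triangular and has square zero
(`exists_sqZeroUpper_of_mem_borel`). Gaussian elimination then writes `X = G w_< H` with triangular
`G`, `H` acting only on the rows in `I` and the columns in `J` (`exists_rookEquiv`). Since `I` and
`J` are disjoint, `G H⁻¹` conjugates `w_<` to `X` and fixes `U_L` and `U_M`. So one group element
places `X` in `B · w_<` and the pair of `X` in the orbit of `w` (`RookEquiv.mem_orbits`).

Separation. Triangular operations cannot make a southwest minor nonzero once it is larger than the
number of nonzero entries of the original matrix in that corner. For partial permutation matrices
these counts determine the matrix. This separates the orbits of pairs (`eq_of_mem_orbit`) and,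
because minors are polynomials, gives antisymmetry of the adjoint order (`adjointLE_antisymm`).

Comparison of closures. Two polynomial maps transport vanishing conditions. From matrices to frames,
`X ↦ (g (1 + P_I X P_J) U_L, g U_M)` sends `B · w_<` into the orbit of pairs of `w`
(`orbit_subset_closure_of_mem_closure`). From frames to matrices, `schurMap` is the Schur complement
with denominators cleared by adjugates; it sends all frames over the orbit of `w` into `B · w_<` and
the standard frame of `v` to `v_<` (`schurMap_mem_adjointOrbit`, `schurMap_upperPart`,
`adjointLE_of_mem_closure`). Antisymmetry for pairs is then inherited from the adjoint order. -/

noncomputable section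

namespace DoubleGrassmannian

variable {n : ℕ}

/-! ### Coordinate projections and upper triangular matrices -/

/-- The coordinate projection onto the span of the `e_i` with `i ∈ L`. -/
def coordProj (L : Finset (Fin n)) : Matrix (Fin n) (Fin n) ℂ :=
  Matrix.diagonal fun i => if i ∈ L then 1 else 0

theorem coordProj_mul_apply (L : Finset (Fin n)) (X : Matrix (Fin n) (Fin n) ℂ) (i j : Fin n) :
    (coordProj L * X) i j = if i ∈ L then X i j else 0 := by
  simp [coordProj, Matrix.diagonal_mul]

theorem mul_coordProj_apply (L : Finset (Fin n)) (X : Matrix (Fin n) (Fin n) ℂ) (i j : Fin n) :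
    (X * coordProj L) i j = if j ∈ L then X i j else 0 := by
  simp [coordProj, Matrix.mul_diagonal]

theorem coordProj_mul_coordProj (L M : Finset (Fin n)) :
    coordProj L * coordProj M = coordProj (L ∩ M) := by
  ext i j
  rw [coordProj_mul_apply]
  by_cases h : i = j
  · subst h; by_cases h1 : i ∈ L <;> by_cases h2 : i ∈ M <;> simp [coordProj, h1, h2]
  · simp [coordProj, h]

theorem coordProj_compl (L : Finset (Fin n)) : coordProj Lᶜ = 1 - coordProj L := by
  ext i j
  by_cases h : i = j
  · subst h; by_cases h1 : i ∈ L <;> simp [coordProj, h1]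
  · simp [coordProj, h]

theorem coordProj_empty : coordProj (∅ : Finset (Fin n)) = 0 := by
  ext i j; simp [coordProj]

theorem coordProj_commute (L : Finset (Fin n)) (X : Matrix (Fin n) (Fin n) ℂ)
    (h : ∀ i j, X i j ≠ 0 → (i ∈ L ↔ j ∈ L)) : Commute X (coordProj L) := by
  ext i j
  rw [coordProj_mul_apply, mul_coordProj_apply]
  by_cases hX : X i j = 0
  · simp [hX]
  · have := h i j hX
    simp [this]

theorem coordProj_mul_eq_self_iff (L : Finset (Fin n)) (X : Matrix (Fin n) (Fin n) ℂ) :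
    coordProj L * X = X ↔ ∀ i j, X i j ≠ 0 → i ∈ L := by
  rw [← Matrix.ext_iff]
  simp only [coordProj_mul_apply]
  refine forall_congr' fun i => forall_congr' fun j => ?_
  by_cases h : i ∈ L <;> simp [h, eq_comm]

theorem mul_coordProj_eq_self_iff (L : Finset (Fin n)) (X : Matrix (Fin n) (Fin n) ℂ) :
    X * coordProj L = X ↔ ∀ i j, X i j ≠ 0 → j ∈ L := by
  rw [← Matrix.ext_iff]
  simp only [mul_coordProj_apply]
  refine forall_congr' fun i => forall_congr' fun j => ?_
  by_cases h : j ∈ L <;> simp [h, eq_comm]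

theorem coordProj_blockTriangular (L : Finset (Fin n)) : (coordProj L).BlockTriangular id :=
  Matrix.blockTriangular_diagonal _

theorem mem_borel_iff (g : GL (Fin n) ℂ) :
    g ∈ borel n ↔ (g : Matrix (Fin n) (Fin n) ℂ).BlockTriangular id := Iff.rfl

theorem BlockTriangular.mul_diag {X Y : Matrix (Fin n) (Fin n) ℂ}
    (hX : X.BlockTriangular id) (hY : Y.BlockTriangular id) (i : Fin n) :
    (X * Y) i i = X i i * Y i i := by
  rw [Matrix.mul_apply]
  refine Finset.sum_eq_single_of_mem i (Finset.mem_univ _) fun j _ hj => ?_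
  rcases lt_or_gt_of_ne hj with h | h
  · rw [hX (show id j < id i from h), zero_mul]
  · rw [hY (show id i < id j from h), mul_zero]

theorem exists_mem_borel {X : Matrix (Fin n) (Fin n) ℂ} (hX : X.BlockTriangular id)
    (hd : ∀ i, X i i ≠ 0) : ∃ g ∈ borel n, (g : Matrix (Fin n) (Fin n) ℂ) = X := by
  have hdet : X.det ≠ 0 := by
    rw [Matrix.det_of_isUpperTriangular hX]
    exact Finset.prod_ne_zero_iff.2 fun i _ => hd i
  exact ⟨Matrix.GeneralLinearGroup.mkOfDetNeZero X hdet, hX, rfl⟩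

theorem diag_ne_zero_of_mem_borel {g : GL (Fin n) ℂ} (hg : g ∈ borel n) (i : Fin n) :
    (g : Matrix (Fin n) (Fin n) ℂ) i i ≠ 0 := by
  have h := (g.isUnit.map Matrix.detMonoidHom).ne_zero
  rw [Matrix.coe_detMonoidHom, Matrix.det_of_isUpperTriangular ((mem_borel_iff g).1 hg)] at h
  exact Finset.prod_ne_zero_iff.1 h i (Finset.mem_univ i)

/-! ### Involutions and their strictly upper triangular parts -/

theorem involutions_apply_apply (w : involutions n) (i : Fin n) : w.1 (w.1 i) = i := by
  have h := w.2
  simp only [involutions, Set.mem_ofPred_eq, sq] at h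
  simpa using congrArg (fun f => f i) h

theorem upperPart_apply (w : involutions n) (i j : Fin n) :
    (upperPart w).1 i j = if w.1 i = j ∧ i < j then 1 else 0 := rfl

/-- An involution is determined by its arcs, and each arc appears as an entry once its smaller
endpoint is taken as row. -/
theorem upperPart_injective : Function.Injective fun w : involutions n => (upperPart w).1 := by
  intro v w h
  have key : ∀ v w : involutions n, (upperPart v).1 = (upperPart w).1 → ∀ i, v.1 i ≠ i →
      v.1 i = w.1 i := by
    intro v w h i hi
    rcases lt_or_gt_of_ne hi with h1 | h1
    · have := congrFun (congrFun h (v.1 i)) i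
      rw [upperPart_apply, upperPart_apply, if_pos ⟨involutions_apply_apply v i, h1⟩] at this
      have h2 : w.1 (v.1 i) = i := by
        by_contra hc
        simp [hc] at this
      rw [← involutions_apply_apply w (v.1 i), h2]
    · have := congrFun (congrFun h i) (v.1 i)
      rw [upperPart_apply, upperPart_apply, if_pos ⟨rfl, h1⟩] at this
      by_contra hc
      simp [Ne.symm hc] at this
  refine Subtype.ext (Equiv.ext fun i => ?_)
  by_cases h1 : v.1 i = i
  · by_cases h2 : w.1 i = i
    · rw [h1, h2]
    · exact (key w v h.symm i h2).symm
  · exact key v w h i h1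

/-! ### Rook normal form -/

/-- `S` is obtained from the strictly upper triangular part of `w` by triangular row operations on
the rows in `I` and triangular column operations on the columns in `J`. -/
def RookEquiv (I J : Finset (Fin n)) (S : Matrix (Fin n) (Fin n) ℂ) (w : involutions n) : Prop :=
  ∃ G H : Matrix (Fin n) (Fin n) ℂ, G.BlockTriangular id ∧ H.BlockTriangular id ∧
    (∀ i, G i i ≠ 0) ∧ (∀ i, H i i ≠ 0) ∧
    (∀ i j, G i j ≠ (1 : Matrix (Fin n) (Fin n) ℂ) i j → i ∈ I ∧ j ∈ I) ∧
    (∀ i j, H i j ≠ (1 : Matrix (Fin n) (Fin n) ℂ) i j → i ∈ J ∧ j ∈ J) ∧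
    S = G * (upperPart w).1 * H

/-- All arcs of `w` lead from `I` to `J`. -/
def ArcsIn (I J : Finset (Fin n)) (w : involutions n) : Prop :=
  ∀ i j, i < j → w.1 i = j → i ∈ I ∧ j ∈ J

theorem one_add_col_mul_apply (i : Fin n) (u : Fin n → ℂ) (X : Matrix (Fin n) (Fin n) ℂ)
    (r c : Fin n) :
    ((1 + Matrix.of fun r c => if c = i then u r else 0) * X) r c = X r c + u r * X i c := by
  rw [add_mul, one_mul, Matrix.add_apply, Matrix.mul_apply]
  simp

theorem mul_one_add_row_apply (a : Fin n) (u : Fin n → ℂ) (X : Matrix (Fin n) (Fin n) ℂ)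
    (r c : Fin n) :
    (X * (1 + Matrix.of fun r c => if r = a then u c else 0)) r c = X r c + X r a * u c := by
  rw [mul_add, mul_one, Matrix.add_apply, Matrix.mul_apply]
  simp

-- Gaussian elimination, one column at a time from the left. Each pivot becomes an arc and its row
-- leaves `I`, its column leaves `J`. The supports of `G` and `H` are tracked because the later
-- conjugation depends on them.
set_option maxHeartbeats 800000 in
theorem exists_rookEquiv (I J : Finset (Fin n)) (hIJ : Disjoint I J)
    (S : Matrix (Fin n) (Fin n) ℂ) (hS : ∀ i j, S i j ≠ 0 → i ∈ I ∧ j ∈ J ∧ i < j) :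
    ∃ w, ArcsIn I J w ∧ RookEquiv I J S w := by
  induction J using Finset.induction_on_min generalizing I S with
  | empty =>
    refine ⟨⟨1, by simp [involutions]⟩, ?_, 1, 1, Matrix.blockTriangular_one,
      Matrix.blockTriangular_one, by simp, by simp, by simp, by simp, ?_⟩
    · rintro i j hij rfl
      exact absurd hij (lt_irrefl _)
    · ext i j
      have : S i j = 0 := by
        by_contra h
        simpa using (hS i j h).2.1
      simp only [this, one_mul, mul_one, upperPart_apply]
      rw [if_neg]
      rintro ⟨h, h2⟩
      exact absurd h h2.ne
  | insert a s has ih =>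
    have has' : a ∉ s := fun h => lt_irrefl _ (has a h)
    have haI : a ∉ I := fun h => Finset.disjoint_left.1 hIJ h (Finset.mem_insert_self _ _)
    have hIs : Disjoint I s := hIJ.mono_right (Finset.subset_insert _ _)
    by_cases hcol : ∀ i, S i a = 0
    · obtain ⟨w, hw, G, H, h1, h2, h3, h4, h5, h6, h7⟩ := ih I hIs S (by
        intro i j h
        obtain ⟨hi, hj, hlt⟩ := hS i j h
        refine ⟨hi, (Finset.mem_insert.1 hj).resolve_left ?_, hlt⟩
        rintro rfl
        exact h (hcol i))
      refine ⟨w, fun i j hij h => ?_, G, H, h1, h2, h3, h4, h5, fun i j h => ?_, h7⟩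
      · exact (hw i j hij h).imp_right (Finset.mem_insert_of_mem ·)
      · exact (h6 i j h).imp (Finset.mem_insert_of_mem ·) (Finset.mem_insert_of_mem ·)
    · push Not at hcol
      -- The lowest nonzero entry of the leftmost column is the pivot: clearing the entries above it
      -- and to its right uses only upper triangular operations.
      obtain ⟨i, hi, hmax⟩ : ∃ i, S i a ≠ 0 ∧ ∀ r, S r a ≠ 0 → r ≤ i := by
        obtain ⟨i, hi, hmax⟩ := Finset.exists_max_image
          (Finset.univ.filter fun i => S i a ≠ 0) id
          (by obtain ⟨i, hi⟩ := hcol; exact ⟨i, by simpa using hi⟩)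
        exact ⟨i, by simpa using hi, fun r hr => hmax r (by simpa using hr)⟩
      obtain ⟨hiI, -, hia⟩ := hS i a hi
      -- Subtracting this rank one matrix clears row `i` and column `a`. New nonzero entries stay
      -- above the diagonal because `r < a < c`.
      let S' : Matrix (Fin n) (Fin n) ℂ := Matrix.of fun r c => S r c - S r a * S i c / S i a
      have hS'i : ∀ c, S' i c = 0 := fun c => by simp [S', mul_div_cancel_left₀ _ hi]
      have hS'a : ∀ r, S' r a = 0 := fun r => by simp [S', hi]
      obtain ⟨w, hw, G, H, h1, h2, h3, h4, h5, h6, h7⟩ := ih (I.erase i)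
        (hIs.mono_left (Finset.erase_subset _ _)) S' (by
        intro r c hrc
        have hri : r ≠ i := by rintro rfl; exact hrc (hS'i c)
        have hca : c ≠ a := by rintro rfl; exact hrc (hS'a r)
        have : r ∈ I ∧ c ∈ insert a s ∧ r < c := by
          by_cases h : S r c = 0
          · have h' : S r a ≠ 0 ∧ S i c ≠ 0 := by
              constructor <;> intro h0 <;> simp [S', h, h0] at hrc
            have e1 := hS r a h'.1
            have e2 := hS i c h'.2
            exact ⟨e1.1, e2.2.1, e1.2.2.trans
              (has c ((Finset.mem_insert.1 e2.2.1).resolve_left hca))⟩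
          · exact hS r c h
        exact ⟨Finset.mem_erase.2 ⟨hri, this.1⟩,
          (Finset.mem_insert.1 this.2.1).resolve_left hca, this.2.2⟩)
      have hfix : ∀ x, x ∉ I.erase i → x ∉ s → w.1 x = x := by
        intro x hx1 hx2
        by_contra hne
        rcases lt_or_gt_of_ne hne with h | h
        · exact hx2 (hw _ _ h (involutions_apply_apply w x)).2
        · exact hx1 (hw _ _ h rfl).1
      have hwi : w.1 i = i := hfix i (Finset.notMem_erase _ _)
        (Finset.disjoint_left.1 hIs hiI)
      have hwa : w.1 a = a := hfix a (fun h => haI (Finset.mem_of_mem_erase h)) has'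
      have hsw : ∀ x, x ≠ i → x ≠ a → (w.1 * Equiv.swap i a) x = w.1 x := fun x h1 h2 => by
        simp [Equiv.swap_apply_of_ne_of_ne h1 h2]
      have hswi : (w.1 * Equiv.swap i a) i = a := by simp [hwa]
      have hswa : (w.1 * Equiv.swap i a) a = i := by simp [hwi]
      let w' : involutions n := ⟨w.1 * Equiv.swap i a, by
        change _ ^ 2 = _
        ext1 x
        rw [sq, Equiv.Perm.mul_apply, Equiv.Perm.one_apply]
        by_cases hx1 : x = i
        · rw [hx1, hswi, hswa]
        by_cases hx2 : x = a
        · rw [hx2, hswa, hswi]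
        rw [hsw x hx1 hx2, hsw, involutions_apply_apply]
        · intro h; apply hx1; rw [← involutions_apply_apply w x, h, hwi]
        · intro h; apply hx2; rw [← involutions_apply_apply w x, h, hwa]⟩
      have hup : (upperPart w').1 = (upperPart w).1 + Matrix.single i a 1 := by
        ext r c
        rw [Matrix.add_apply, upperPart_apply, upperPart_apply]
        change (if (w.1 * Equiv.swap i a) r = c ∧ _ then _ else _) = _
        by_cases hr1 : r = i
        · subst hr1
          rw [hswi, hwi]
          by_cases hc : a = c
          · subst hc; simp [hia, hia.ne]
          · rw [if_neg (by tauto), if_neg (by rintro ⟨rfl, h⟩; exact lt_irrefl _ h)]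
            simp [Matrix.single, hc]
        by_cases hr2 : r = a
        · subst hr2
          rw [hswa, hwa, if_neg (by rintro ⟨rfl, h⟩; exact lt_asymm h hia),
            if_neg (by rintro ⟨rfl, h⟩; exact lt_irrefl _ h)]
          simp [Matrix.single, Ne.symm hr1]
        rw [hsw r hr1 hr2]
        simp [Matrix.single, Ne.symm hr1]
      -- `P` is the identity with column `i` replaced by column `a` of `S`, and `R` the identity
      -- with row `a` replaced by row `i` of `S` divided by the pivot. Thus `S = P (S' + E_ia) R`.
      -- Triangularity of `P` uses the maximality of `i`, that of `R` the minimality of `a`.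
      let P : Matrix (Fin n) (Fin n) ℂ :=
        1 + Matrix.of fun r c => if c = i then S r a - (1 : Matrix (Fin n) (Fin n) ℂ) r i else 0
      let R : Matrix (Fin n) (Fin n) ℂ :=
        1 + Matrix.of fun r c => if r = a then S i c / S i a - (1 : Matrix (Fin n) (Fin n) ℂ) a c
          else 0
      have hPi : ∀ r, P r i = S r a := fun r => by simp [P]
      have hPne : ∀ r c, c ≠ i → P r c = (1 : Matrix (Fin n) (Fin n) ℂ) r c :=
        fun r c h => by simp [P, h]
      have hRa : ∀ c, R a c = S i c / S i a := fun r => by simp [R]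
      have hRne : ∀ r c, r ≠ a → R r c = (1 : Matrix (Fin n) (Fin n) ℂ) r c :=
        fun r c h => by simp [R, h]
      have hP : P.BlockTriangular id := by
        intro r c hrc
        by_cases hc : c = i
        · subst hc
          rw [hPi]
          by_contra h
          exact absurd (hmax r h) (not_le.2 hrc)
        · rw [hPne r c hc, Matrix.one_apply_ne]
          rintro rfl; exact lt_irrefl _ hrc
      have hR : R.BlockTriangular id := by
        intro r c hrc
        by_cases hr : r = a
        · subst hr
          rw [hRa]
          by_cases h : S i c = 0
          · simp [h]
          · rcases Finset.mem_insert.1 (hS i c h).2.1 with rfl | h'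
            · exact absurd hrc (lt_irrefl _)
            · exact absurd hrc (has c h').not_gt
        · rw [hRne r c hr, Matrix.one_apply_ne]
          rintro rfl; exact lt_irrefl _ hrc
      have hGi : ∀ r c, c ∉ I.erase i → G r c = (1 : Matrix (Fin n) (Fin n) ℂ) r c :=
        fun r c h => by
          by_contra h'
          exact h (h5 r c h').2
      have hHa : ∀ r c, r ∉ s → H r c = (1 : Matrix (Fin n) (Fin n) ℂ) r c :=
        fun r c h => by
          by_contra h'
          exact h (h6 r c h').1
      -- The factors found by induction do not touch the pivot: `G` is the identity in column `i`,
      -- and `H` in row `a`.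
      have hGs : G * Matrix.single i a 1 * H = Matrix.single i a 1 := by
        ext r c
        simp only [Matrix.mul_apply, Matrix.single_apply, Finset.sum_mul]
        rw [Finset.sum_eq_single a, Finset.sum_eq_single i]
        · rw [hGi r i (Finset.notMem_erase _ _), hHa a c has']
          simp only [Matrix.one_apply, eq_comm]
          by_cases e1 : i = r <;> by_cases e2 : a = c <;> simp [e1, e2]
        · intro b _ hb; simp [hb.symm]
        · simp
        · intro b _ hb; simp [hb.symm]
        · simp
      refine ⟨w', ?_, P * G, H * R, hP.mul h1, h2.mul hR, fun x => ?_, fun x => ?_, ?_, ?_, ?_⟩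
      · intro r c hrc h
        change (w.1 * Equiv.swap i a) r = c at h
        by_cases hr1 : r = i
        · rw [hr1, hswi] at h
          exact ⟨hr1 ▸ hiI, h ▸ Finset.mem_insert_self _ _⟩
        by_cases hr2 : r = a
        · rw [hr2, hswa] at h
          rw [hr2, ← h] at hrc
          exact absurd hrc hia.not_gt
        rw [hsw r hr1 hr2] at h
        exact (hw r c hrc h).imp (Finset.mem_of_mem_erase ·) (Finset.mem_insert_of_mem ·)
      · rw [BlockTriangular.mul_diag hP h1]
        refine mul_ne_zero ?_ (h3 x)
        by_cases hx : x = i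
        · rw [hx, hPi]; exact hi
        · rw [hPne x x hx]; simp
      · rw [BlockTriangular.mul_diag h2 hR]
        refine mul_ne_zero (h4 x) ?_
        by_cases hx : x = a
        · rw [hx, hRa]; simpa using hi
        · rw [hRne x x hx]; simp
      · intro r c h
        by_contra hc
        apply h
        have : (P * G) r c = G r c + (S r a - (1 : Matrix (Fin n) (Fin n) ℂ) r i) * G i c := by
          simp only [P, one_add_col_mul_apply]
        rw [this]
        by_cases hcI : c ∈ I
        · have hrI : r ∉ I := fun h => hc ⟨h, hcI⟩
          have e1 : S r a = 0 := by
            by_contra h; exact hrI (hS r a h).1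
          have e2 : r ≠ i := by rintro rfl; exact hrI hiI
          have e3 : G r c = (1 : Matrix (Fin n) (Fin n) ℂ) r c := by
            by_contra h; exact hrI (Finset.mem_of_mem_erase (h5 r c h).1)
          simp [e1, e2, e3]
        · have hci : i ≠ c := by rintro rfl; exact hcI hiI
          rw [hGi r c (fun h => hcI (Finset.mem_of_mem_erase h)),
            hGi i c (fun h => hcI (Finset.mem_of_mem_erase h)), Matrix.one_apply_ne hci]
          simp
      · intro r c h
        by_contra hc
        apply h
        have : (H * R) r c =
            H r c + H r a * (S i c / S i a - (1 : Matrix (Fin n) (Fin n) ℂ) a c) := by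
          simp only [R, mul_one_add_row_apply]
        rw [this]
        by_cases hrJ : r ∈ insert a s
        · have hcJ : c ∉ insert a s := fun h => hc ⟨hrJ, h⟩
          have e1 : S i c = 0 := by
            by_contra h; exact hcJ (hS i c h).2.1
          have e2 : a ≠ c := by rintro rfl; exact hcJ (Finset.mem_insert_self _ _)
          have e3 : H r c = (1 : Matrix (Fin n) (Fin n) ℂ) r c := by
            by_contra h; exact hcJ (Finset.mem_insert_of_mem (h6 r c h).2)
          simp [e1, e2, e3]
        · have hra : r ≠ a := by rintro rfl; exact hrJ (Finset.mem_insert_self _ _)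
          rw [hHa r c (fun h => hrJ (Finset.mem_insert_of_mem h)),
            hHa r a (fun h => hrJ (Finset.mem_insert_of_mem h)), Matrix.one_apply_ne hra]
          simp
      · have e : P * G * ((upperPart w).1 + Matrix.single i a 1) * (H * R) =
            P * (G * (upperPart w).1 * H + G * Matrix.single i a 1 * H) * R := by
          noncomm_ring
        rw [hup, e, ← h7, hGs]
        have e1 : P * (S' + Matrix.single i a 1) =
            S' + Matrix.of fun r c => if c = a then S r a else 0 := by
          ext r c
          rw [one_add_col_mul_apply]
          simp only [Matrix.add_apply, hS'i, Matrix.single_apply, Matrix.one_apply, Matrix.of_apply]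
          by_cases hr : r = i <;> by_cases hc : c = a <;> simp [hr, hc, Ne.symm]
        rw [e1]
        ext r c
        rw [mul_one_add_row_apply]
        simp only [Matrix.add_apply, hS'a, Matrix.of_apply, Matrix.one_apply]
        by_cases hc : c = a
        · subst hc; simp [hS'a, hi]
        · simp [hc, Ne.symm hc, S']
          ring

/-! ### From row and column operations to conjugation -/

theorem coe_inv_mul_cancel (g : GL (Fin n) ℂ) :
    ((g⁻¹ : GL (Fin n) ℂ) : Matrix (Fin n) (Fin n) ℂ) * (g : Matrix (Fin n) (Fin n) ℂ) = 1 := by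
  rw [← Units.val_mul, inv_mul_cancel, Units.val_one]

theorem coe_mul_inv_cancel (g : GL (Fin n) ℂ) :
    (g : Matrix (Fin n) (Fin n) ℂ) * ((g⁻¹ : GL (Fin n) ℂ) : Matrix (Fin n) (Fin n) ℂ) = 1 := by
  rw [← Units.val_mul, mul_inv_cancel, Units.val_one]

theorem mul_eq_zero_of_forall {X Y : Matrix (Fin n) (Fin n) ℂ}
    (h : ∀ a b c, X a b ≠ 0 → Y b c = 0) : X * Y = 0 := by
  ext a c
  rw [Matrix.mul_apply]
  refine Finset.sum_eq_zero fun b _ => ?_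
  by_cases hX : X a b = 0
  · rw [hX, zero_mul]
  · rw [h a b c hX, mul_zero]

theorem ArcsIn.of_upperPart_ne_zero {I J : Finset (Fin n)} {w : involutions n}
    (h : ArcsIn I J w) {i j : Fin n} (hij : (upperPart w).1 i j ≠ 0) : i ∈ I ∧ j ∈ J := by
  rw [upperPart_apply] at hij
  by_cases hc : w.1 i = j ∧ i < j
  · exact h i j hc.2 hc.1
  · rw [if_neg hc] at hij
    exact absurd rfl hij

/-- Take `g = G H⁻¹`. As `I` and `J` are disjoint, `H` fixes `w_<` from the left and `G` fixes `w_<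
H` from the right, so both sides equal `G w_<`. The commutation holds since `G - 1` and `H - 1` are
supported in `I × I` and `J × J`; it makes `g` preserve both coordinate subspaces. -/
theorem RookEquiv.exists_conj {I J : Finset (Fin n)} (hIJ : Disjoint I J)
    {S : Matrix (Fin n) (Fin n) ℂ} {w : involutions n} (hw : ArcsIn I J w)
    (h : RookEquiv I J S w) :
    ∃ g ∈ borel n, (∀ L, Disjoint I L → J ⊆ L →
      Commute (g : Matrix (Fin n) (Fin n) ℂ) (coordProj L)) ∧
      S * (g : Matrix (Fin n) (Fin n) ℂ) = (g : Matrix (Fin n) (Fin n) ℂ) * (upperPart w).1 := by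
  obtain ⟨G, H, hG, hH, hGd, hHd, hGI, hHJ, rfl⟩ := h
  have hHw : H * (upperPart w).1 = (upperPart w).1 := by
    have : (H - 1) * (upperPart w).1 = 0 := by
      refine mul_eq_zero_of_forall fun a b c hab => ?_
      by_contra hbc
      rw [Matrix.sub_apply, sub_ne_zero] at hab
      exact Finset.disjoint_left.1 hIJ (hw.of_upperPart_ne_zero hbc).1 (hHJ a b hab).2
    rwa [sub_mul, one_mul, sub_eq_zero] at this
  have hwHG : (upperPart w).1 * H * G = (upperPart w).1 * H := by
    have : (upperPart w).1 * H * (G - 1) = 0 := by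
      refine mul_eq_zero_of_forall fun a b c hab => ?_
      by_contra hbc
      have hbI := (hGI b c (sub_ne_zero.1 hbc)).1
      apply hab
      rw [Matrix.mul_apply]
      refine Finset.sum_eq_zero fun x _ => ?_
      by_contra hx
      have hxJ := (hw.of_upperPart_ne_zero (left_ne_zero_of_mul hx)).2
      have hHx := right_ne_zero_of_mul hx
      have hbJ : b ∉ J := Finset.disjoint_left.1 hIJ hbI
      have hne : x ≠ b := by rintro rfl; exact hbJ hxJ
      exact hbJ (hHJ x b (by rwa [Matrix.one_apply_ne hne])).2
    rwa [mul_sub, mul_one, sub_eq_zero] at this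
  obtain ⟨g, hg, rfl⟩ := exists_mem_borel hG hGd
  obtain ⟨h, hh, rfl⟩ := exists_mem_borel hH hHd
  refine ⟨g * h⁻¹, mul_mem hg (inv_mem hh), fun L hIL hJL => ?_, ?_⟩
  · have h1 : Commute (g : Matrix (Fin n) (Fin n) ℂ) (coordProj L) := by
      refine coordProj_commute _ _ fun i j hij => ?_
      by_cases hne : i = j
      · rw [hne]
      · have := hGI i j (by rwa [Matrix.one_apply_ne hne])
        exact iff_of_false (Finset.disjoint_left.1 hIL this.1) (Finset.disjoint_left.1 hIL this.2)
    have h2 : Commute (h : Matrix (Fin n) (Fin n) ℂ) (coordProj L) := by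
      refine coordProj_commute _ _ fun i j hij => ?_
      by_cases hne : i = j
      · rw [hne]
      · have := hHJ i j (by rwa [Matrix.one_apply_ne hne])
        exact iff_of_true (hJL this.1) (hJL this.2)
    rw [Units.val_mul]
    exact h1.mul_left h2.units_inv_left
  · rw [Units.val_mul]
    have e : ((h⁻¹ : GL (Fin n) ℂ) : Matrix (Fin n) (Fin n) ℂ) * (upperPart w).1 =
        (upperPart w).1 := by
      conv_lhs => rw [← hHw, ← mul_assoc, coe_inv_mul_cancel, one_mul]
    calc _ = (g : Matrix (Fin n) (Fin n) ℂ) * ((upperPart w).1 * h * g) *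
          ((h⁻¹ : GL (Fin n) ℂ) : Matrix (Fin n) (Fin n) ℂ) := by simp only [mul_assoc]
      _ = (g : Matrix (Fin n) (Fin n) ℂ) * (upperPart w).1 := by
        rw [hwHG, mul_assoc, mul_assoc, coe_mul_inv_cancel, mul_one]
      _ = _ := by rw [mul_assoc, e]

theorem mem_adjointOrbit_of_mul_eq {X : SqZeroUpper n} {w : involutions n} {g : GL (Fin n) ℂ}
    (hg : g ∈ borel n) (h : X.1 * (g : Matrix (Fin n) (Fin n) ℂ) =
      (g : Matrix (Fin n) (Fin n) ℂ) * (upperPart w).1) : X ∈ adjointOrbit w :=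
  ⟨g, hg, by rw [← h, mul_assoc, coe_mul_inv_cancel, mul_one]⟩

/-! ### Counting the entries of southwest submatrices -/

/-- The number of nonzero entries in the rows from `i` on and in the columns before `j`. -/
def swCount (Y : Matrix (Fin n) (Fin n) ℂ) (i j : ℕ) : ℕ :=
  (Finset.univ.filter fun p : Fin n × Fin n => i ≤ p.1 ∧ (p.2 : ℕ) < j ∧ Y p.1 p.2 ≠ 0).card

/-- Inclusion and exclusion for four neighbouring corners; it recovers the support of a matrix from
its counts. -/
theorem swCount_recurrence (Y : Matrix (Fin n) (Fin n) ℂ) (a b : Fin n) :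
    swCount Y a (b + 1) + swCount Y (a + 1) b =
      swCount Y a b + swCount Y (a + 1) (b + 1) + if Y a b ≠ 0 then 1 else 0 := by
  have h : (if Y a b ≠ 0 then 1 else 0) =
      ∑ p : Fin n × Fin n, if p = (a, b) then (if Y p.1 p.2 ≠ 0 then 1 else 0) else 0 := by
    rw [Finset.sum_ite_eq' Finset.univ (a, b)]
    simp
  rw [h]
  simp only [swCount, Finset.card_filter, ← Finset.sum_add_distrib]
  refine Finset.sum_congr rfl fun p _ => ?_
  by_cases hY : Y p.1 p.2 = 0
  · simp [hY]
  · have hp : p = (a, b) ↔ (p.1 : ℕ) = a ∧ (p.2 : ℕ) = b := by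
      rw [Prod.ext_iff, Fin.ext_iff, Fin.ext_iff]
    simp only [hY, hp, ne_eq, not_false_eq_true, and_true, if_true]
    split_ifs <;> omega

theorem ne_zero_iff_of_swCount_eq {Y Z : Matrix (Fin n) (Fin n) ℂ}
    (h : ∀ i j, swCount Y i j = swCount Z i j) (a b : Fin n) : Y a b ≠ 0 ↔ Z a b ≠ 0 := by
  have h1 := swCount_recurrence Y a b
  have h2 := swCount_recurrence Z a b
  rw [h, h, h, h] at h1
  by_cases hY : Y a b = 0 <;> by_cases hZ : Z a b = 0 <;> simp [hY, hZ] at h1 h2 ⊢ <;> omega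

theorem det_mul_eq_zero_of_card_lt {ι κ : Type*} [Fintype ι] [DecidableEq ι] [Fintype κ]
    (A : Matrix ι κ ℂ) (B : Matrix κ ι ℂ) (h : Fintype.card κ < Fintype.card ι) :
    (A * B).det = 0 := by
  by_contra hd
  have h1 := Matrix.rank_of_isUnit (A * B) ((Matrix.isUnit_iff_isUnit_det _).2 (Ne.isUnit hd))
  have h2 := (Matrix.rank_mul_le_left A B).trans (Matrix.rank_le_card_width A)
  omega

/-- By triangularity only entries of `Y` in the same southwest corner contribute, so the submatrix
factors through the set of nonzero entries there and its rank is at most their number. Invertibility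
of `G` and `H` is not needed, which later allows projections as factors. -/
theorem det_submatrix_eq_zero {G Y H : Matrix (Fin n) (Fin n) ℂ} (hG : G.BlockTriangular id)
    (hH : H.BlockTriangular id) {i j : ℕ} {ι : Type*} [Fintype ι] [DecidableEq ι]
    {f h : ι → Fin n} (hf : ∀ s, i ≤ f s) (hh : ∀ s, (h s : ℕ) < j)
    (hc : swCount Y i j < Fintype.card ι) : ((G * Y * H).submatrix f h).det = 0 := by
  let P := Finset.univ.filter fun p : Fin n × Fin n => i ≤ p.1 ∧ (p.2 : ℕ) < j ∧ Y p.1 p.2 ≠ 0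
  have : (G * Y * H).submatrix f h =
      (Matrix.of fun s (p : P) => G (f s) p.1.1) *
        (Matrix.of fun (p : P) t => Y p.1.1 p.1.2 * H p.1.2 (h t)) := by
    ext s t
    simp only [Matrix.submatrix_apply, Matrix.mul_apply, Matrix.of_apply, Finset.sum_mul]
    rw [Finset.sum_comm, ← Fintype.sum_prod_type'
      (f := fun a b => G (f s) a * Y a b * H b (h t)),
      Finset.sum_coe_sort P (fun p => G (f s) p.1 * (Y p.1 p.2 * H p.2 (h t)))]
    simp only [mul_assoc]
    symm
    refine Finset.sum_subset (Finset.subset_univ _) fun p _ hp => ?_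
    by_contra hne
    have h1 := left_ne_zero_of_mul hne
    have h2 := left_ne_zero_of_mul (right_ne_zero_of_mul hne)
    have h3 := right_ne_zero_of_mul (right_ne_zero_of_mul hne)
    have e1 : f s ≤ p.1 := not_lt.1 fun h => h1 (hG h)
    have e2 : p.2 ≤ h t := not_lt.1 fun h => h3 (hH h)
    have e3 : (f s : ℕ) ≤ p.1 := e1
    have e4 : (p.2 : ℕ) ≤ h t := e2
    refine hp (Finset.mem_filter.2 ⟨Finset.mem_univ _, (hf s).trans e3, ?_, h2⟩)
    have := hh t
    omega
  rw [this]
  exact det_mul_eq_zero_of_card_lt _ _ (by rw [Fintype.card_coe]; exact hc)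

/-- A matrix of zeros and ones with at most one nonzero entry in every row and every column. -/
structure IsRook (Z : Matrix (Fin n) (Fin n) ℂ) : Prop where
  eq_one : ∀ i j, Z i j ≠ 0 → Z i j = 1
  row : ∀ i j j', Z i j ≠ 0 → Z i j' ≠ 0 → j = j'
  col : ∀ i i' j, Z i j ≠ 0 → Z i' j ≠ 0 → i = i'

/-- The nonzero positions in the corner, used as both rows and columns of a minor, give an identity
matrix. Its determinant is `1`, so there cannot be more than `c` of them. -/
theorem IsRook.swCount_le {Z : Matrix (Fin n) (Fin n) ℂ} (hZ : IsRook Z) {c i j : ℕ}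
    (h : ∀ (ι : Finset (Fin n × Fin n)), (∀ s ∈ ι, i ≤ (s.1 : ℕ)) → (∀ s ∈ ι, (s.2 : ℕ) < j) →
      c < ι.card → (Z.submatrix (fun s : ι => s.1.1) (fun s : ι => s.1.2)).det = 0) :
    swCount Z i j ≤ c := by
  by_contra! hc
  have h0 := h _ (fun s hs => (Finset.mem_filter.1 hs).2.1)
    (fun s hs => (Finset.mem_filter.1 hs).2.2.1) hc
  have h1 : (Z.submatrix
      (fun s : Finset.univ.filter fun p : Fin n × Fin n =>
        i ≤ p.1 ∧ (p.2 : ℕ) < j ∧ Z p.1 p.2 ≠ 0 => s.1.1)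
      (fun s : Finset.univ.filter fun p : Fin n × Fin n =>
        i ≤ p.1 ∧ (p.2 : ℕ) < j ∧ Z p.1 p.2 ≠ 0 => s.1.2)) = 1 := by
    ext s t
    have hs := (Finset.mem_filter.1 s.2).2.2.2
    have ht := (Finset.mem_filter.1 t.2).2.2.2
    rw [Matrix.submatrix_apply]
    by_cases hst : s = t
    · rw [hst, Matrix.one_apply_eq, hZ.eq_one _ _ ht]
    · rw [Matrix.one_apply_ne hst]
      by_contra hne
      exact hst (Subtype.ext (Prod.ext (hZ.col _ _ _ hne ht) (hZ.row _ _ _ hs hne)))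
  rw [h1, Matrix.det_one] at h0
  exact one_ne_zero h0

theorem IsRook.ext {Y Z : Matrix (Fin n) (Fin n) ℂ} (hY : IsRook Y) (hZ : IsRook Z)
    (h1 : ∀ i j, swCount Y i j ≤ swCount Z i j) (h2 : ∀ i j, swCount Z i j ≤ swCount Y i j) :
    Y = Z := by
  have h := ne_zero_iff_of_swCount_eq fun i j => (h1 i j).antisymm (h2 i j)
  ext i j
  by_cases hY0 : Y i j = 0
  · have : Z i j = 0 := by
      by_contra hc
      exact (h i j).2 hc hY0
    rw [hY0, this]
  · rw [hY.eq_one i j hY0, hZ.eq_one i j ((h i j).1 hY0)]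

theorem isRook_upperPart (w : involutions n) : IsRook (upperPart w).1 where
  eq_one i j h := by
    rw [upperPart_apply] at h ⊢
    split_ifs at h ⊢ with hc
    · rfl
    · exact absurd rfl h
  row i j j' h h' := by
    rw [upperPart_apply] at h h'
    split_ifs at h h' with h1 h2
    · exact h1.1.symm.trans h2.1
    all_goals simp at h h'
  col i i' j h h' := by
    rw [upperPart_apply] at h h'
    split_ifs at h h' with h1 h2
    · exact w.1.injective (h1.1.trans h2.1.symm)
    all_goals simp at h h'

theorem isRook_upperPart_add {I J T : Finset (Fin n)} {w : involutions n} (hw : ArcsIn I J w)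
    (hIT : Disjoint I T) (hJT : Disjoint J T) : IsRook ((upperPart w).1 + coordProj T) := by
  have hR := isRook_upperPart w
  have key : ∀ i j, ((upperPart w).1 + coordProj T) i j ≠ 0 →
      ((upperPart w).1 i j ≠ 0 ∧ i ∈ I ∧ j ∈ J ∧ ((upperPart w).1 + coordProj T) i j = 1) ∨
      (i = j ∧ i ∈ T ∧ ((upperPart w).1 + coordProj T) i j = 1) := by
    intro i j h
    by_cases h0 : (upperPart w).1 i j = 0
    · right
      rw [Matrix.add_apply, h0, zero_add] at h ⊢
      by_cases hij : i = j
      · subst hij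
        by_cases hT : i ∈ T
        · simp [coordProj, hT]
        · simp [coordProj, hT] at h
      · simp [coordProj, hij] at h
    · left
      have hm := hw.of_upperPart_ne_zero h0
      refine ⟨h0, hm.1, hm.2, ?_⟩
      rw [Matrix.add_apply, hR.eq_one i j h0]
      have : i ∉ T := Finset.disjoint_left.1 hIT hm.1
      simp [coordProj, Matrix.diagonal_apply, this]
  refine ⟨fun i j h => ?_, fun i j j' h h' => ?_, fun i i' j h h' => ?_⟩
  · rcases key i j h with h | h
    exacts [h.2.2.2, h.2.2]
  · rcases key i j h with h | h <;> rcases key i j' h' with h' | h'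
    · exact hR.row i j j' h.1 h'.1
    · exact absurd h'.2.1 (Finset.disjoint_left.1 hIT h.2.1)
    · exact absurd h.2.1 (Finset.disjoint_left.1 hIT h'.2.1)
    · exact h.1.symm.trans h'.1
  · rcases key i j h with h | h <;> rcases key i' j h' with h' | h'
    · exact hR.col i i' j h.1 h'.1
    · exact absurd (h'.1 ▸ h'.2.1) (Finset.disjoint_left.1 hJT h.2.2.1)
    · exact absurd (h.1 ▸ h.2.1) (Finset.disjoint_left.1 hJT h'.2.2.1)
    · exact h.1.trans h'.1.symm

theorem IsRook.swCount_le_of_eq_mul {Y Z G H : Matrix (Fin n) (Fin n) ℂ} (hZ : IsRook Z)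
    (hG : G.BlockTriangular id) (hH : H.BlockTriangular id) (h : Z = G * Y * H) (i j : ℕ) :
    swCount Z i j ≤ swCount Y i j := by
  refine hZ.swCount_le fun ι h1 h2 hc => ?_
  rw [h]
  exact det_submatrix_eq_zero hG hH (fun s => h1 s.1 s.2) (fun s => h2 s.1 s.2) (by simpa using hc)

/-! ### Frames -/

theorem Frame.coe_span {k : ℕ} (F : Frame k n) : F.span.1 = LinearMap.range F.1.mulVecLin :=
  (Matrix.range_mulVecLin F.1).symm

theorem Frame.mulVec_injective {k : ℕ} (F : Frame k n) : Function.Injective F.1.mulVec :=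
  Matrix.mulVec_injective_iff.2 F.2

theorem Frame.span_eq_of_eq_mul {k : ℕ} {F F' : Frame k n} (a : Matrix (Fin k) (Fin k) ℂ)
    (h : F'.1 = F.1 * a) : F.span = F'.span := by
  have hle : F'.span.1 ≤ F.span.1 := by
    rw [Frame.coe_span, Frame.coe_span, h, Matrix.mulVecLin_mul]
    exact LinearMap.range_comp_le_range _ _
  exact Subtype.ext (Submodule.eq_of_le_of_finrank_eq hle (F'.span.2.trans F.span.2.symm)).symm

theorem Frame.exists_eq_mul_of_span_eq {k : ℕ} {F F' : Frame k n} (h : F.span = F'.span) :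
    ∃ a : GL (Fin k) ℂ, F'.1 = F.1 * (a : Matrix (Fin k) (Fin k) ℂ) := by
  have hcol : ∀ j, ∃ v, F.1 *ᵥ v = F'.1.col j := by
    intro j
    have h1 : F'.1.col j ∈ F.span.1 := h ▸ Submodule.subset_span ⟨j, rfl⟩
    rw [Frame.coe_span] at h1
    exact h1
  choose v hv using hcol
  let a : Matrix (Fin k) (Fin k) ℂ := Matrix.of fun i j => v j i
  have ha : F'.1 = F.1 * a := by
    ext i j
    exact (congrFun (hv j) i).symm
  have hinj : Function.Injective a.mulVec := by
    intro x y hxy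
    apply F'.mulVec_injective
    simp only [ha, ← Matrix.mulVec_mulVec]
    rw [hxy]
  exact ⟨(Matrix.mulVec_injective_iff_isUnit.1 hinj).unit, ha⟩

/-- The action of `GL n` on frames. -/
def Frame.smul {k : ℕ} (g : GL (Fin n) ℂ) (F : Frame k n) : Frame k n :=
  ⟨(g : Matrix (Fin n) (Fin n) ℂ) * F.1, by
    rw [← Matrix.mulVec_injective_iff]
    intro x y hxy
    apply F.mulVec_injective
    apply Matrix.mulVec_injective_of_isUnit g.isUnit
    simpa [Matrix.mulVec_mulVec] using hxy⟩

theorem Frame.span_smul {k : ℕ} (g : GL (Fin n) ℂ) (F : Frame k n) :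
    (F.smul g).span = g • F.span := by
  apply Subtype.ext
  change _ = F.span.1.map (Matrix.toLin' (g : Matrix (Fin n) (Fin n) ℂ))
  rw [Frame.coe_span, Frame.coe_span, Frame.smul, Matrix.mulVecLin_mul, LinearMap.range_comp]
  rfl

/-- The action of `GL k` on frames by change of basis. -/
def Frame.rebase {k : ℕ} (F : Frame k n) (a : GL (Fin k) ℂ) : Frame k n :=
  ⟨F.1 * (a : Matrix (Fin k) (Fin k) ℂ), by
    rw [← Matrix.mulVec_injective_iff]
    intro x y hxy
    apply Matrix.mulVec_injective_of_isUnit a.isUnit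
    apply F.mulVec_injective
    simpa [Matrix.mulVec_mulVec] using hxy⟩

/-! ### Coordinate subspaces -/

section Coord

variable {k m : ℕ} {L M : Finset (Fin n)} (hL : L.card = k) (hM : M.card = m)

/-- The `k × n` matrix selecting the coordinates in `L`. -/
def sel : Matrix (Fin k) (Fin n) ℂ :=
  (1 : Matrix (Fin n) (Fin n) ℂ).submatrix (L.orderEmbOfFin hL) id

theorem sel_mul {p : ℕ} (X : Matrix (Fin n) (Fin p) ℂ) :
    sel hL * X = X.submatrix (L.orderEmbOfFin hL) id := by
  ext i j
  simp [sel, Matrix.mul_apply, Matrix.one_apply]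

theorem sel_mul_transpose : sel hL * (sel hL)ᵀ = 1 := by
  rw [sel_mul]
  ext i j
  simp [sel, Matrix.one_apply]

theorem transpose_mul_sel : (sel hL)ᵀ * sel hL = coordProj L := by
  ext i j
  rw [Matrix.mul_apply]
  simp only [sel, Matrix.transpose_apply, Matrix.submatrix_apply, id, Matrix.one_apply]
  by_cases hi : i ∈ L
  · have : i ∈ Set.range (L.orderEmbOfFin hL) := by
      rw [Finset.range_orderEmbOfFin]; exact hi
    obtain ⟨a, rfl⟩ := this
    rw [Finset.sum_eq_single a]
    · simp [coordProj, Matrix.diagonal_apply]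
    · intro b _ hb
      rw [if_neg (by simpa using hb), zero_mul]
    · simp
  · rw [Finset.sum_eq_zero]
    · simp [coordProj, Matrix.diagonal_apply, hi]
    · intro a _
      rw [if_neg, zero_mul]
      rintro rfl
      exact hi (Finset.orderEmbOfFin_mem L hL a)

theorem coordProj_mul_sel_transpose : coordProj L * (sel hL)ᵀ = (sel hL)ᵀ := by
  rw [← transpose_mul_sel hL, Matrix.mul_assoc, sel_mul_transpose, Matrix.mul_one]

theorem sel_mul_coordProj : sel hL * coordProj L = sel hL := by
  rw [← transpose_mul_sel hL, ← Matrix.mul_assoc, sel_mul_transpose, Matrix.one_mul]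

/-- The standard frame of the coordinate subspace of `L`. -/
def coordFrame : Frame k n :=
  ⟨(sel hL)ᵀ, by
    rw [← Matrix.mulVec_injective_iff]
    refine Function.LeftInverse.injective (g := (sel hL).mulVec) fun x => ?_
    rw [Matrix.mulVec_mulVec, sel_mul_transpose, Matrix.one_mulVec]⟩

/-- The coordinate subspace of `L`. -/
def coordSpace : Gr k n := (coordFrame hL).span

theorem smul_coordSpace_eq_of_mul_eq {g h : GL (Fin n) ℂ}
    (e : (g : Matrix (Fin n) (Fin n) ℂ) * coordProj L = h * coordProj L) :
    g • coordSpace hL = h • coordSpace hL := by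
  have : (coordFrame hL).smul g = (coordFrame hL).smul h := by
    apply Subtype.ext
    change (g : Matrix (Fin n) (Fin n) ℂ) * (sel hL)ᵀ = h.1 * (sel hL)ᵀ
    rw [← coordProj_mul_sel_transpose, ← Matrix.mul_assoc, e, Matrix.mul_assoc]
  rw [coordSpace, ← Frame.span_smul, ← Frame.span_smul, this]

theorem smul_coordSpace_eq_self_iff {g : GL (Fin n) ℂ} :
    g • coordSpace hL = coordSpace hL ↔
      coordProj Lᶜ * (g : Matrix (Fin n) (Fin n) ℂ) * coordProj L = 0 := by
  constructor
  · intro h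
    rw [coordSpace, ← Frame.span_smul] at h
    obtain ⟨a, ha⟩ := Frame.exists_eq_mul_of_span_eq h.symm
    change (g : Matrix (Fin n) (Fin n) ℂ) * (sel hL)ᵀ = (sel hL)ᵀ * a.1 at ha
    have h0 : coordProj Lᶜ * (sel hL)ᵀ = 0 := by
      rw [coordProj_compl, Matrix.sub_mul, Matrix.one_mul, coordProj_mul_sel_transpose, sub_self]
    rw [← transpose_mul_sel hL, Matrix.mul_assoc, ← Matrix.mul_assoc _ _ (sel hL), ha,
      ← Matrix.mul_assoc, ← Matrix.mul_assoc, h0, Matrix.zero_mul, Matrix.zero_mul]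
  · intro h
    rw [coordSpace, ← Frame.span_smul]
    refine (Frame.span_eq_of_eq_mul (sel hL * g.1 * (sel hL)ᵀ) ?_).symm
    change (g : Matrix (Fin n) (Fin n) ℂ) * (sel hL)ᵀ = (sel hL)ᵀ * (sel hL * g.1 * (sel hL)ᵀ)
    rw [← Matrix.mul_assoc, ← Matrix.mul_assoc, transpose_mul_sel]
    rw [coordProj_compl, sub_mul, sub_mul, one_mul, sub_eq_zero] at h
    have := congrArg (· * (sel hL)ᵀ) h
    simpa only [Matrix.mul_assoc, coordProj_mul_sel_transpose] using this

theorem smul_coordSpace_eq_self_of_commute {g : GL (Fin n) ℂ}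
    (h : Commute (g : Matrix (Fin n) (Fin n) ℂ) (coordProj L)) :
    g • coordSpace hL = coordSpace hL := by
  rw [smul_coordSpace_eq_self_iff, mul_assoc, h.eq, ← mul_assoc, coordProj_mul_coordProj,
    Finset.inter_comm, Finset.inter_compl, coordProj_empty, zero_mul]

theorem coordPoint_eq_coordSpace {lam : YoungDiagram} (h : Fits k n lam)
    (hL' : (Finset.univ.filter fun j : Fin n => bit k n lam j = 1).card = k) :
    coordPoint h = coordSpace hL' := by
  apply Subtype.ext
  change Submodule.span ℂ _ = Submodule.span ℂ _
  congr 1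
  have hr := Finset.range_orderEmbOfFin _ hL'
  have : {j : Fin n | bit k n lam j = 1} = Set.range (Finset.orderEmbOfFin _ hL') := by
    rw [hr]; simp
  rw [this, ← Set.range_comp]
  congr 1
  ext a i
  simp [coordFrame, sel, stdVec, Pi.single_apply, Matrix.one_apply]

/-! ### Pairs attached to square zero matrices -/

/-- The unipotent matrix `1 + X`. -/
def oneAdd (X : SqZeroUpper n) : GL (Fin n) ℂ where
  val := 1 + X.1
  inv := 1 - X.1
  val_inv := by rw [mul_sub, add_mul, add_mul, X.2.2]; simp
  inv_val := by rw [mul_add, sub_mul, sub_mul, X.2.2]; simp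

theorem coe_oneAdd (X : SqZeroUpper n) : (oneAdd X : Matrix (Fin n) (Fin n) ℂ) = 1 + X.1 := rfl

theorem blockTriangular_sqZeroUpper (X : SqZeroUpper n) : X.1.BlockTriangular id :=
  fun i j h => X.2.1 i j (le_of_lt h)

theorem oneAdd_mem_borel (X : SqZeroUpper n) : oneAdd X ∈ borel n :=
  (mem_borel_iff _).2 (Matrix.blockTriangular_one.add (blockTriangular_sqZeroUpper X))

/-- The pair of subspaces `((1 + X) U_L, U_M)`. -/
def pairPoint (X : SqZeroUpper n) : Gr k n × Gr m n := (oneAdd X • coordSpace hL, coordSpace hM)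

/-- Conjugation turns into translation of pairs: `g (1 + w_<) = (1 + X) g`, while `g` fixes both
coordinate subspaces. -/
theorem pairPoint_mem_orbit {X : SqZeroUpper n} {w : involutions n} {g : GL (Fin n) ℂ}
    (hg : g ∈ borel n) (hgL : Commute (g : Matrix (Fin n) (Fin n) ℂ) (coordProj L))
    (hgM : Commute (g : Matrix (Fin n) (Fin n) ℂ) (coordProj M))
    (h : X.1 * (g : Matrix (Fin n) (Fin n) ℂ) =
      (g : Matrix (Fin n) (Fin n) ℂ) * (upperPart w).1) :
    pairPoint hL hM X ∈ MulAction.orbit (borel n) (pairPoint hL hM (upperPart w)) := by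
  refine ⟨⟨g, hg⟩, Prod.ext ?_ (smul_coordSpace_eq_self_of_commute hM hgM)⟩
  change g • oneAdd (upperPart w) • coordSpace hL = oneAdd X • coordSpace hL
  have e : g * oneAdd (upperPart w) = oneAdd X * g := by
    apply Units.ext
    simp only [Units.val_mul, coe_oneAdd, mul_add, add_mul, h, mul_one, one_mul]
  rw [smul_smul, e, mul_smul, smul_coordSpace_eq_self_of_commute hL hgL]

theorem mul_eq_of_smul_coordSpace {g h : GL (Fin n) ℂ}
    (e : g • coordSpace hL = h • coordSpace hL) :
    coordProj Lᶜ * ((g⁻¹ * h : GL (Fin n) ℂ) : Matrix (Fin n) (Fin n) ℂ) * coordProj L = 0 := by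
  rw [← smul_coordSpace_eq_self_iff hL, mul_smul, ← e, inv_smul_smul]

theorem coordProj_mul_oneAdd_mul_coordProj {w : involutions n}
    (hw : ArcsIn (L ∪ M)ᶜ (L ∩ M) w) :
    coordProj Mᶜ * (1 + (upperPart w).1) * coordProj L = (upperPart w).1 + coordProj (L \ M) := by
  have h1 : coordProj Mᶜ * (upperPart w).1 = (upperPart w).1 := by
    rw [coordProj_mul_eq_self_iff]
    intro i j hij
    have := (hw.of_upperPart_ne_zero hij).1
    simp only [Finset.mem_compl, Finset.mem_union, not_or] at this ⊢
    exact this.2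
  have h2 : (upperPart w).1 * coordProj L = (upperPart w).1 := by
    rw [mul_coordProj_eq_self_iff]
    intro i j hij
    exact (Finset.mem_inter.1 (hw.of_upperPart_ne_zero hij).2).1
  have h3 : Mᶜ ∩ L = L \ M := by
    ext; simp [and_comm]
  rw [mul_add, mul_one, h1, add_mul, h2, coordProj_mul_coordProj, h3, add_comm]

/-- If `g` carries one pair to the other, then `1 + u_< = g (1 + w_<) q` with `g` stabilising `U_M`
and `q` stabilising `U_L`. Compressing by `P_{Mᶜ}` on the left and `P_L` on the right keeps the
product form and replaces `1 + w_<` by `w_< + P_{L \ M}`. This is why the diagonal block occurs in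
the counts. -/
theorem swCount_le_of_mem_orbit {u w : involutions n} (hu : ArcsIn (L ∪ M)ᶜ (L ∩ M) u)
    (hw : ArcsIn (L ∪ M)ᶜ (L ∩ M) w)
    (h : pairPoint hL hM (upperPart u) ∈
      MulAction.orbit (borel n) (pairPoint hL hM (upperPart w))) (i j : ℕ) :
    swCount ((upperPart u).1 + coordProj (L \ M)) i j ≤
      swCount ((upperPart w).1 + coordProj (L \ M)) i j := by
  obtain ⟨⟨g, hg⟩, h⟩ := h
  have hgM : g • coordSpace hM = coordSpace hM := congrArg Prod.snd h
  have hgL : g • oneAdd (upperPart w) • coordSpace hL = oneAdd (upperPart u) • coordSpace hL :=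
    congrArg Prod.fst h
  rw [smul_smul] at hgL
  have h1 := (smul_coordSpace_eq_self_iff hM).1 hgM
  have h2 := mul_eq_of_smul_coordSpace hL hgL
  set q := (g * oneAdd (upperPart w))⁻¹ * oneAdd (upperPart u) with hq
  have hqB : q ∈ borel n :=
    mul_mem (inv_mem (mul_mem hg (oneAdd_mem_borel _))) (oneAdd_mem_borel _)
  have e : (1 + (upperPart u).1) = (g : Matrix (Fin n) (Fin n) ℂ) * (1 + (upperPart w).1) * q := by
    have : oneAdd (upperPart u) = g * oneAdd (upperPart w) * q := by rw [hq]; group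
    simpa only [Units.val_mul, coe_oneAdd] using congrArg Units.val this
  have hqL : (q : Matrix (Fin n) (Fin n) ℂ) * coordProj L = coordProj L * (q * coordProj L) := by
    rw [coordProj_compl, sub_mul, sub_mul, one_mul, sub_eq_zero] at h2
    rw [← mul_assoc, ← h2]
  have hgM' : coordProj Mᶜ * (g : Matrix (Fin n) (Fin n) ℂ) =
      coordProj Mᶜ * g * coordProj Mᶜ := by
    rw [coordProj_compl M, mul_sub, ← coordProj_compl M, h1, mul_one, sub_zero]
  refine (isRook_upperPart_add hu ?_ ?_).swCount_le_of_eq_mul (G := coordProj Mᶜ * g.1)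
    (H := q.1 * coordProj L) ((coordProj_blockTriangular _).mul ((mem_borel_iff g).1 hg))
    (((mem_borel_iff q).1 hqB).mul (coordProj_blockTriangular _)) ?_ i j
  · rw [Finset.disjoint_left]
    intro x hx
    simp only [Finset.mem_compl, Finset.mem_union, not_or, Finset.mem_sdiff] at hx ⊢
    tauto
  · rw [Finset.disjoint_left]
    intro x hx
    simp only [Finset.mem_inter, Finset.mem_sdiff] at hx ⊢
    tauto
  · rw [← coordProj_mul_oneAdd_mul_coordProj hu, ← coordProj_mul_oneAdd_mul_coordProj hw, e]
    calc _ = (coordProj Mᶜ * (g : Matrix (Fin n) (Fin n) ℂ)) * (1 + (upperPart w).1) *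
          (q.1 * coordProj L) := by simp only [mul_assoc]
      _ = (coordProj Mᶜ * g.1 * coordProj Mᶜ) * (1 + (upperPart w).1) *
          (coordProj L * (q.1 * coordProj L)) := by rw [← hgM', ← hqL]
      _ = _ := by simp only [mul_assoc]

theorem eq_of_mem_orbit {u w : involutions n} (hu : ArcsIn (L ∪ M)ᶜ (L ∩ M) u)
    (hw : ArcsIn (L ∪ M)ᶜ (L ∩ M) w)
    (h : pairPoint hL hM (upperPart u) ∈
      MulAction.orbit (borel n) (pairPoint hL hM (upperPart w))) : u = w := by
  have d1 : Disjoint (L ∪ M)ᶜ (L \ M) := by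
    rw [Finset.disjoint_left]
    intro x hx
    simp only [Finset.mem_compl, Finset.mem_union, not_or, Finset.mem_sdiff] at hx ⊢
    tauto
  have d2 : Disjoint (L ∩ M) (L \ M) := by
    rw [Finset.disjoint_left]
    intro x hx
    simp only [Finset.mem_inter, Finset.mem_sdiff] at hx ⊢
    tauto
  have := IsRook.ext (isRook_upperPart_add hu d1 d2) (isRook_upperPart_add hw d1 d2)
    (swCount_le_of_mem_orbit hL hM hu hw h)
    (swCount_le_of_mem_orbit hL hM hw hu (MulAction.mem_orbit_symm.1 h))
  exact upperPart_injective (add_right_cancel this)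

end Coord

/-! ### Reduction to square zero matrices -/

theorem coordProj_apply_self (L : Finset (Fin n)) (i : Fin n) :
    coordProj L i i = if i ∈ L then 1 else 0 := by
  simp [coordProj]

/-- Block elimination without coordinates. With `K` the inverse of `C` on the block of `e`, the
outer factors clear the rest of the rows and columns of that block. They commute with `f` and `l`
respectively, so they can be pulled out of the compression. -/
theorem schur_reduction {R : Type*} [Ring R] {e f l b C K : R} (hfe : f * e = e) (hef : e * f = e)
    (hel : e * l = e) (hle : l * e = e) (hff : f * f = f) (hll : l * l = l) (hC : f * b * l = C)
    (hKe : K * e = K) (heK : e * K = K) (hKC : K * C * e = e) (hCK : e * C * K = e) :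
    f * ((1 + e - C * K) * b * (1 + e - K * C)) * l = C - C * K * C + e * C * e := by
  have hfC : f * C = C := by rw [← hC, ← mul_assoc, ← mul_assoc, hff]
  have hCl : C * l = C := by rw [← hC, mul_assoc, hll]
  have hKf : K * f = K := by rw [← hKe, mul_assoc, hef]
  have hlK : l * K = K := by rw [← heK, ← mul_assoc, hle]
  have hKCK : K * C * K = K := by
    calc K * C * K = K * C * e * K := by rw [mul_assoc (K * C), heK]
      _ = K := by rw [hKC, heK]
  have h1 : f * (1 + e - C * K) = (1 + e - C * K) * f := by
    rw [mul_sub, sub_mul, mul_add, add_mul, hfe, hef, mul_one, one_mul, ← mul_assoc, hfC,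
      mul_assoc C, hKf]
  have h2 : (1 + e - K * C) * l = l * (1 + e - K * C) := by
    rw [mul_sub, sub_mul, mul_add, add_mul, hle, hel, mul_one, one_mul, ← mul_assoc, hlK,
      mul_assoc K, hCl]
  have h3 : (1 + e - C * K) * C * (1 + e - K * C) =
      C + (C * e - C * (K * C * e)) - C * K * C + (e * C - (e * C * K) * C) + e * C * e
        - C * K * C + C * (K * C * K) * C := by
    noncomm_ring
  calc _ = (f * (1 + e - C * K)) * b * ((1 + e - K * C) * l) := by simp only [mul_assoc]
    _ = (1 + e - C * K) * (f * b * l) * (1 + e - K * C) := by rw [h1, h2]; simp only [mul_assoc]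
    _ = _ := by
      rw [hC, h3, hKC, hCK, hKCK, sub_self, sub_self]
      abel

/-- Completing the block by the identity gives an invertible triangular `d` commuting with `P_T`;
then `K = d⁻¹ P_T`. -/
theorem exists_inverse_of_block {C : Matrix (Fin n) (Fin n) ℂ} (hC : C.BlockTriangular id)
    {T : Finset (Fin n)} (hT : ∀ i ∈ T, C i i ≠ 0) :
    ∃ K : Matrix (Fin n) (Fin n) ℂ, K.BlockTriangular id ∧ K * coordProj T = K ∧
      coordProj T * K = K ∧ K * C * coordProj T = coordProj T ∧
      coordProj T * C * K = coordProj T := by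
  have hee : coordProj T * coordProj T = coordProj T := by
    rw [coordProj_mul_coordProj, Finset.inter_self]
  obtain ⟨d, hd, hdD⟩ := exists_mem_borel
    (X := coordProj T * C * coordProj T + (1 - coordProj T))
    ((((coordProj_blockTriangular T).mul hC).mul (coordProj_blockTriangular T)).add
      (Matrix.blockTriangular_one.sub (coordProj_blockTriangular T))) (by
      intro i
      rw [Matrix.add_apply, mul_coordProj_apply, coordProj_mul_apply, ← coordProj_compl]
      by_cases hi : i ∈ T <;> simp [hi, coordProj, hT])
  have hde : d.1 * coordProj T = coordProj T * C * coordProj T := by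
    rw [hdD, add_mul, sub_mul, one_mul, hee, sub_self, add_zero, mul_assoc, hee]
  have hed : coordProj T * d.1 = coordProj T * C * coordProj T := by
    rw [hdD, mul_add, mul_sub, mul_one, hee, sub_self, add_zero, ← mul_assoc, ← mul_assoc, hee]
  have hcomm : Commute d.1 (coordProj T) := by rw [Commute, SemiconjBy, hde, hed]
  have hcomm' : Commute (d⁻¹).1 (coordProj T) := hcomm.units_inv_left
  refine ⟨(d⁻¹).1 * coordProj T,
    ((mem_borel_iff _).1 (inv_mem hd)).mul (coordProj_blockTriangular T), ?_, ?_, ?_, ?_⟩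
  · rw [mul_assoc, hee]
  · rw [← mul_assoc, ← hcomm'.eq, mul_assoc, hee]
  · rw [mul_assoc, mul_assoc, ← mul_assoc (coordProj T), ← hde, ← mul_assoc, coe_inv_mul_cancel,
      one_mul]
  · rw [hcomm'.eq, ← mul_assoc, ← hed, mul_assoc, coe_mul_inv_cancel, mul_one]

theorem inverse_of_block_unique {R : Type*} [Ring R] {e C K K' : R} (hKe : K * e = K)
    (hKC : K * C * e = e) (heK' : e * K' = K') (hCK' : e * C * K' = e) : K = K' := by
  calc K = K * (e * C * K') := by rw [hCK', hKe]
    _ = K * C * (e * K') := by rw [heK', ← mul_assoc, ← mul_assoc, hKe]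
    _ = K' := by rw [← mul_assoc, hKC, heK']

section Reduction

variable {k m : ℕ} {L M : Finset (Fin n)} (hL : L.card = k) (hM : M.card = m)

/-- The block `P_{Mᶜ} b P_L` determines `b U_L` up to the stabiliser of `U_M` in `B`. Let `x` have
the columns of `b` in `L` and those of `c` elsewhere: `x U_L = b U_L`, and `x - c` has image in
`U_M`, so `x c⁻¹` fixes `U_M`. -/
theorem exists_borel_smul_eq {b c : GL (Fin n) ℂ} (hb : b ∈ borel n) (hc : c ∈ borel n)
    (h : coordProj Mᶜ * b.1 * coordProj L = coordProj Mᶜ * c.1 * coordProj L) :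
    ∃ p ∈ borel n, p • coordSpace hM = coordSpace hM ∧
      p • c • coordSpace hL = b • coordSpace hL := by
  have hLL : coordProj L * coordProj L = coordProj L := by
    rw [coordProj_mul_coordProj, Finset.inter_self]
  have hcLL : coordProj Lᶜ * coordProj L = 0 := by
    rw [coordProj_mul_coordProj, Finset.inter_comm, Finset.inter_compl, coordProj_empty]
  obtain ⟨x, hx, hxX⟩ := exists_mem_borel (X := b.1 * coordProj L + c.1 * coordProj Lᶜ)
    ((((mem_borel_iff b).1 hb).mul (coordProj_blockTriangular L)).add
      (((mem_borel_iff c).1 hc).mul (coordProj_blockTriangular Lᶜ))) (by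
      intro i
      rw [Matrix.add_apply, mul_coordProj_apply, mul_coordProj_apply]
      by_cases hi : i ∈ L <;>
        simp [hi, diag_ne_zero_of_mem_borel hb, diag_ne_zero_of_mem_borel hc])
  refine ⟨x * c⁻¹, mul_mem hx (inv_mem hc), ?_, ?_⟩
  · rw [smul_coordSpace_eq_self_iff]
    have e : x.1 = c.1 + (b.1 - c.1) * coordProj L := by
      rw [hxX, coordProj_compl]; noncomm_ring
    have e' : coordProj Mᶜ * (x * c⁻¹).1 = coordProj Mᶜ := by
      have h0 : coordProj Mᶜ * ((b.1 - c.1) * coordProj L) = 0 := by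
        rw [sub_mul, mul_sub, ← mul_assoc, ← mul_assoc, h, sub_self]
      rw [Units.val_mul, ← mul_assoc, e, mul_add, h0, add_zero, mul_assoc, coe_mul_inv_cancel,
        mul_one]
    rw [e', coordProj_mul_coordProj, Finset.inter_comm, Finset.inter_compl, coordProj_empty]
  · rw [smul_smul, inv_mul_cancel_right]
    apply smul_coordSpace_eq_of_mul_eq
    rw [hxX, add_mul, mul_assoc, mul_assoc, hLL, hcLL, mul_zero, add_zero]

/-- Elimination inside `B` replaces `C` by its Schur complement plus the block on `L \ M`, which is
also the compression of `(1 + X) d` for a `d` fixing `U_L`. The matrix `K` is left as a parameter so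
that an adjugate formula can be inserted later. -/
theorem exists_sqZeroUpper_of_mem_borel {b : GL (Fin n) ℂ} (hb : b ∈ borel n)
    {C K : Matrix (Fin n) (Fin n) ℂ} (hC : coordProj Mᶜ * b.1 * coordProj L = C)
    (hKe : K * coordProj (L \ M) = K) (hKC : K * C * coordProj (L \ M) = coordProj (L \ M)) :
    ∃ X : SqZeroUpper n, X.1 = C - C * K * C ∧
      (∀ i j, X.1 i j ≠ 0 → i ∈ (L ∪ M)ᶜ ∧ j ∈ L ∩ M) ∧
      (b • coordSpace hL, coordSpace hM) ∈ MulAction.orbit (borel n) (pairPoint hL hM X) := by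
  have hCtri : C.BlockTriangular id := by
    rw [← hC]
    exact ((coordProj_blockTriangular _).mul ((mem_borel_iff b).1 hb)).mul
      (coordProj_blockTriangular _)
  have hCdiag : ∀ i ∈ L \ M, C i i ≠ 0 := by
    intro i hi
    rw [Finset.mem_sdiff] at hi
    rw [← hC, mul_coordProj_apply, coordProj_mul_apply, if_pos hi.1,
      if_pos (Finset.mem_compl.2 hi.2)]
    exact diag_ne_zero_of_mem_borel hb i
  -- The one-sided conditions on `K` already force it to be the triangular two-sided inverse of the
  -- block.
  obtain ⟨K', hK'tri, hK'e, heK', hK'C, hCK'⟩ := exists_inverse_of_block hCtri hCdiag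
  obtain rfl := inverse_of_block_unique hKe hKC heK' hCK'
  set e := coordProj (L \ M) with he
  have hfe : coordProj Mᶜ * e = e := by
    rw [he, coordProj_mul_coordProj]; congr 1; ext; simp
  have hef : e * coordProj Mᶜ = e := by
    rw [he, coordProj_mul_coordProj]; congr 1; ext; simp
  have hle : coordProj L * e = e := by
    rw [he, coordProj_mul_coordProj]; congr 1; ext; simp
  have hel : e * coordProj L = e := by
    rw [he, coordProj_mul_coordProj]; congr 1; ext; simp; tauto
  have hff : coordProj Mᶜ * coordProj Mᶜ = coordProj Mᶜ := by
    rw [coordProj_mul_coordProj, Finset.inter_self]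
  have hll : coordProj L * coordProj L = coordProj L := by
    rw [coordProj_mul_coordProj, Finset.inter_self]
  have hee : e * e = e := by rw [he, coordProj_mul_coordProj, Finset.inter_self]
  have hfC : coordProj Mᶜ * C = C := by rw [← hC, ← mul_assoc, ← mul_assoc, hff]
  have hCl : C * coordProj L = C := by rw [← hC, mul_assoc, hll]
  have hKf : K * coordProj Mᶜ = K := by rw [← hKe, mul_assoc, hef]
  have hlK : coordProj L * K = K := by rw [← heK', ← mul_assoc, hle]
  set S := C - C * K * C with hS
  have heS : e * S = 0 := by
    rw [hS, mul_sub, ← mul_assoc, ← mul_assoc, hCK', sub_self]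
  have hSe : S * e = 0 := by
    rw [hS, sub_mul, mul_assoc (C * K), mul_assoc C K, ← mul_assoc K, hK'C, sub_self]
  have hfS : coordProj Mᶜ * S = S := by
    rw [hS, mul_sub, ← mul_assoc, ← mul_assoc, hfC]
  have hSl : S * coordProj L = S := by
    rw [hS, sub_mul, mul_assoc (C * K), hCl]
  -- Rows lie in `Mᶜ` and columns in `L`; elimination removes `L \ M` from both. Strictness and
  -- square zero follow from the disjointness of the two remaining sets.
  have hsupp : ∀ i j, S i j ≠ 0 → i ∈ (L ∪ M)ᶜ ∧ j ∈ L ∩ M := by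
    intro i j hij
    have h1 := (coordProj_mul_eq_self_iff _ _).1 hfS i j hij
    have h2 := (mul_coordProj_eq_self_iff _ _).1 hSl i j hij
    have h3 : i ∉ L \ M := by
      intro h
      have := congrFun (congrFun heS i) j
      rw [he, coordProj_mul_apply, if_pos h] at this
      exact hij this
    have h4 : j ∉ L \ M := by
      intro h
      have := congrFun (congrFun hSe i) j
      rw [he, mul_coordProj_apply, if_pos h] at this
      exact hij this
    simp only [Finset.mem_sdiff, Finset.mem_compl, Finset.mem_union, Finset.mem_inter] at *
    tauto
  have hStri : S.BlockTriangular id := hCtri.sub ((hCtri.mul hK'tri).mul hCtri)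
  have hstrict : ∀ i j, j ≤ i → S i j = 0 := by
    intro i j hji
    rcases hji.lt_or_eq with h | rfl
    · exact hStri h
    · by_contra h
      have := hsupp j j h
      simp only [Finset.mem_compl, Finset.mem_union, Finset.mem_inter] at this
      tauto
  have hSS : S * S = 0 := mul_eq_zero_of_forall fun i j l hij => by
    by_contra hjl
    have h1 := (hsupp i j hij).2
    have h2 := (hsupp j l hjl).1
    simp only [Finset.mem_compl, Finset.mem_union, Finset.mem_inter] at h1 h2
    tauto
  let X : SqZeroUpper n := ⟨S, hstrict, hSS⟩
  refine ⟨X, rfl, hsupp, ?_⟩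
  have hetri : e.BlockTriangular id := coordProj_blockTriangular _
  have hone : (1 : Matrix (Fin n) (Fin n) ℂ).BlockTriangular id := Matrix.blockTriangular_one
  obtain ⟨x, hx, hxX⟩ := exists_mem_borel (X := 1 + e - C * K)
    ((hone.add hetri).sub (hCtri.mul hK'tri)) (by
      intro i
      rw [Matrix.sub_apply, Matrix.add_apply]
      by_cases hi : i ∈ L \ M
      · have : (C * K) i i = 1 := by
          have := congrFun (congrFun hCK' i) i
          rw [he, mul_assoc, coordProj_mul_apply, if_pos hi] at this
          rw [this, coordProj_apply_self, if_pos hi]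
        rw [this, he, coordProj_apply_self, if_pos hi]; simp
      · have : (C * K) i i = 0 := by
          rw [← hKe, ← mul_assoc, he, mul_coordProj_apply, if_neg hi]
        rw [this, he, coordProj_apply_self, if_neg hi]; simp)
  obtain ⟨y, hy, hyY⟩ := exists_mem_borel (X := 1 + e - K * C)
    ((hone.add hetri).sub (hK'tri.mul hCtri)) (by
      intro i
      rw [Matrix.sub_apply, Matrix.add_apply]
      by_cases hi : i ∈ L \ M
      · have : (K * C) i i = 1 := by
          have := congrFun (congrFun hK'C i) i
          rw [he, mul_coordProj_apply, if_pos hi] at this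
          rw [this, coordProj_apply_self, if_pos hi]
        rw [this, he, coordProj_apply_self, if_pos hi]; simp
      · have : (K * C) i i = 0 := by
          rw [← heK', mul_assoc, he, coordProj_mul_apply, if_neg hi]
        rw [this, he, coordProj_apply_self, if_neg hi]; simp)
  obtain ⟨d, hd, hdD⟩ := exists_mem_borel (X := e * C * e + (1 - e))
    (((hetri.mul hCtri).mul hetri).add (hone.sub hetri)) (by
      intro i
      rw [Matrix.add_apply, he, mul_coordProj_apply, coordProj_mul_apply, ← coordProj_compl]
      by_cases hi : i ∈ L \ M
      · rw [if_pos hi, if_pos hi, coordProj_apply_self, if_neg (by simpa using hi), add_zero]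
        exact hCdiag i hi
      · rw [if_neg hi, coordProj_apply_self, if_pos (Finset.mem_compl.2 hi)]
        simp)
  have hxM : x • coordSpace hM = coordSpace hM := by
    rw [smul_coordSpace_eq_self_iff, hxX]
    have h1 : coordProj Mᶜ * (1 + e - C * K) = (1 + e - C * K) * coordProj Mᶜ := by
      rw [mul_sub, sub_mul, mul_add, add_mul, hfe, hef, mul_one, one_mul, ← mul_assoc, hfC,
        mul_assoc C, hKf]
    rw [h1, mul_assoc, coordProj_mul_coordProj, Finset.inter_comm, Finset.inter_compl,
      coordProj_empty, mul_zero]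
  have hyL : y • coordSpace hL = coordSpace hL := by
    apply smul_coordSpace_eq_self_of_commute
    rw [hyY, Commute, SemiconjBy]
    rw [mul_sub, sub_mul, mul_add, add_mul, hle, hel, mul_one, one_mul, ← mul_assoc, hlK,
      mul_assoc K, hCl]
  have hdL : d • coordSpace hL = coordSpace hL := by
    apply smul_coordSpace_eq_self_of_commute
    rw [hdD, Commute, SemiconjBy]
    simp only [add_mul, mul_add, sub_mul, mul_sub, mul_one, one_mul, ← mul_assoc, hle]
    rw [mul_assoc (e * C), hel]
  obtain ⟨p, hp, hpM, hpL⟩ := exists_borel_smul_eq hL hM (b := x * b * y) (c := oneAdd X * d)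
    (mul_mem (mul_mem hx hb) hy) (mul_mem (oneAdd_mem_borel X) hd) (by
      simp only [Units.val_mul, hxX, hyY, hdD, coe_oneAdd]
      rw [schur_reduction hfe hef hel hle hff hll hC hKe heK' hK'C hCK']
      change S + e * C * e = coordProj Mᶜ * ((1 + S) * (e * C * e + (1 - e))) * coordProj L
      have h1 : S * (e * C * e + (1 - e)) = S := by
        rw [mul_add, ← mul_assoc, ← mul_assoc, hSe, mul_sub, hSe]; simp
      rw [add_mul, one_mul, h1, mul_add, add_mul, hfS, hSl, mul_add, mul_sub, mul_one, hfe,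
        ← mul_assoc, ← mul_assoc, hfe, add_mul, mul_assoc (e * C), hel, sub_mul, hel,
        coordProj_mul_coordProj]
      have : Mᶜ ∩ L = L \ M := by ext; simp [and_comm]
      rw [this, ← he, sub_self, add_zero, add_comm])
  rw [mul_smul, mul_smul, hyL, mul_smul, hdL] at hpL
  refine ⟨⟨x⁻¹ * p, mul_mem (inv_mem hx) hp⟩, Prod.ext ?_ ?_⟩
  · change (x⁻¹ * p) • oneAdd X • coordSpace hL = b • coordSpace hL
    rw [mul_smul, hpL, inv_smul_smul]
  · change (x⁻¹ * p) • coordSpace hM = coordSpace hM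
    rw [mul_smul, hpM, inv_smul_eq_iff, hxM]

theorem disjoint_compl_union_inter (L M : Finset (Fin n)) : Disjoint (L ∪ M)ᶜ (L ∩ M) := by
  rw [Finset.disjoint_left]
  intro x hx
  simp only [Finset.mem_compl, Finset.mem_union, not_or, Finset.mem_inter] at hx ⊢
  tauto

theorem RookEquiv.mem_orbits {X : SqZeroUpper n} {w : involutions n}
    (hw : ArcsIn (L ∪ M)ᶜ (L ∩ M) w) (h : RookEquiv (L ∪ M)ᶜ (L ∩ M) X.1 w) :
    X ∈ adjointOrbit w ∧
      pairPoint hL hM X ∈ MulAction.orbit (borel n) (pairPoint hL hM (upperPart w)) := by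
  obtain ⟨g, hg, hcomm, hgX⟩ := h.exists_conj (disjoint_compl_union_inter L M) hw
  refine ⟨mem_adjointOrbit_of_mul_eq hg hgX, pairPoint_mem_orbit hL hM hg
    (hcomm L ?_ Finset.inter_subset_left) (hcomm M ?_ Finset.inter_subset_right) hgX⟩
  · exact Finset.disjoint_left.2 fun x hx h => Finset.mem_compl.1 hx (Finset.mem_union_left _ h)
  · exact Finset.disjoint_left.2 fun x hx h => Finset.mem_compl.1 hx (Finset.mem_union_right _ h)

theorem exists_involution_of_mem_borel {b : GL (Fin n) ℂ} (hb : b ∈ borel n)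
    {C K : Matrix (Fin n) (Fin n) ℂ} (hC : coordProj Mᶜ * b.1 * coordProj L = C)
    (hKe : K * coordProj (L \ M) = K) (hKC : K * C * coordProj (L \ M) = coordProj (L \ M)) :
    ∃ w, ArcsIn (L ∪ M)ᶜ (L ∩ M) w ∧ (b • coordSpace hL, coordSpace hM) ∈
      MulAction.orbit (borel n) (pairPoint hL hM (upperPart w)) ∧
      ∃ X ∈ adjointOrbit w, X.1 = C - C * K * C := by
  obtain ⟨X, hX, hsupp, horb⟩ := exists_sqZeroUpper_of_mem_borel hL hM hb hC hKe hKC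
  obtain ⟨w, hw, hr⟩ := exists_rookEquiv _ _ (disjoint_compl_union_inter L M) X.1 (by
    intro i j hij
    obtain ⟨h1, h2⟩ := hsupp i j hij
    refine ⟨h1, h2, ?_⟩
    by_contra hlt
    exact hij (X.2.1 i j (not_lt.1 hlt)))
  have := hr.mem_orbits hL hM hw
  refine ⟨w, hw, ?_, X, this.1, hX⟩
  rw [← MulAction.orbit_eq_iff.2 this.2]
  exact horb

/-- Translating by `c⁻¹` makes the second subspace standard. -/
theorem exists_involution_of_smul {b c : GL (Fin n) ℂ} (hb : b ∈ borel n) (hc : c ∈ borel n) :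
    ∃ w, ArcsIn (L ∪ M)ᶜ (L ∩ M) w ∧ (b • coordSpace hL, c • coordSpace hM) ∈
      MulAction.orbit (borel n) (pairPoint hL hM (upperPart w)) := by
  have hcb : c⁻¹ * b ∈ borel n := mul_mem (inv_mem hc) hb
  obtain ⟨K, -, hKe, -, hKC, -⟩ := exists_inverse_of_block
    (C := coordProj Mᶜ * (c⁻¹ * b).1 * coordProj L) (T := L \ M)
    (((coordProj_blockTriangular _).mul ((mem_borel_iff _).1 hcb)).mul
      (coordProj_blockTriangular _)) (by
      intro i hi
      rw [Finset.mem_sdiff] at hi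
      rw [mul_coordProj_apply, coordProj_mul_apply, if_pos hi.1, if_pos (Finset.mem_compl.2 hi.2)]
      exact diag_ne_zero_of_mem_borel hcb i)
  obtain ⟨w, hw, h, -⟩ := exists_involution_of_mem_borel hL hM hcb rfl hKe hKC
  refine ⟨w, hw, ?_⟩
  rw [← MulAction.orbit_eq_iff.2 h]
  refine ⟨⟨c, hc⟩, Prod.ext ?_ rfl⟩
  change c • (c⁻¹ * b) • coordSpace hL = b • coordSpace hL
  rw [smul_smul, mul_inv_cancel_left]

end Reduction

/-! ### Polynomial functions -/

/-- A function on affine space given by a polynomial. -/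
def IsPolyFun {σ : Type} (f : (σ → ℂ) → ℂ) : Prop :=
  ∃ p : MvPolynomial σ ℂ, ∀ x, MvPolynomial.aeval x p = f x

namespace IsPolyFun

variable {σ : Type} {f g : (σ → ℂ) → ℂ}

theorem coord (s : σ) : IsPolyFun fun x : σ → ℂ => x s := ⟨MvPolynomial.X s, by simp⟩

theorem const (c : ℂ) : IsPolyFun fun _ : σ → ℂ => c := ⟨MvPolynomial.C c, by simp⟩

theorem add (hf : IsPolyFun f) (hg : IsPolyFun g) : IsPolyFun fun x => f x + g x := by
  obtain ⟨p, hp⟩ := hf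
  obtain ⟨q, hq⟩ := hg
  exact ⟨p + q, fun x => by rw [map_add, hp, hq]⟩

theorem sub (hf : IsPolyFun f) (hg : IsPolyFun g) : IsPolyFun fun x => f x - g x := by
  obtain ⟨p, hp⟩ := hf
  obtain ⟨q, hq⟩ := hg
  exact ⟨p - q, fun x => by rw [map_sub, hp, hq]⟩

theorem mul (hf : IsPolyFun f) (hg : IsPolyFun g) : IsPolyFun fun x => f x * g x := by
  obtain ⟨p, hp⟩ := hf
  obtain ⟨q, hq⟩ := hg
  exact ⟨p * q, fun x => by rw [map_mul, hp, hq]⟩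

theorem sum {ι : Type*} (s : Finset ι) {f : ι → (σ → ℂ) → ℂ} (hf : ∀ i, IsPolyFun (f i)) :
    IsPolyFun fun x => ∑ i ∈ s, f i x := by
  choose p hp using hf
  exact ⟨∑ i ∈ s, p i, by simp [hp]⟩

theorem prod {ι : Type*} (s : Finset ι) {f : ι → (σ → ℂ) → ℂ} (hf : ∀ i, IsPolyFun (f i)) :
    IsPolyFun fun x => ∏ i ∈ s, f i x := by
  choose p hp using hf
  exact ⟨∏ i ∈ s, p i, by simp [hp]⟩

theorem comp {τ : Type} (q : MvPolynomial τ ℂ) {f : τ → (σ → ℂ) → ℂ}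
    (hf : ∀ t, IsPolyFun (f t)) : IsPolyFun fun x => MvPolynomial.aeval (fun t => f t x) q := by
  choose p hp using hf
  refine ⟨MvPolynomial.bind₁ p q, fun x => ?_⟩
  rw [MvPolynomial.aeval_bind₁]
  simp only [hp]

end IsPolyFun

/-- A matrix of polynomial functions. -/
def IsPolyMat {σ ι κ : Type} (A : (σ → ℂ) → Matrix ι κ ℂ) : Prop :=
  ∀ i j, IsPolyFun fun x => A x i j

namespace IsPolyMat

variable {σ ι κ l : Type}

theorem const (A : Matrix ι κ ℂ) : IsPolyMat fun _ : σ → ℂ => A := fun _ _ => IsPolyFun.const _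

theorem add {A B : (σ → ℂ) → Matrix ι κ ℂ} (hA : IsPolyMat A) (hB : IsPolyMat B) :
    IsPolyMat fun x => A x + B x := fun i j => (hA i j).add (hB i j)

theorem sub {A B : (σ → ℂ) → Matrix ι κ ℂ} (hA : IsPolyMat A) (hB : IsPolyMat B) :
    IsPolyMat fun x => A x - B x := fun i j => (hA i j).sub (hB i j)

theorem smul {f : (σ → ℂ) → ℂ} {B : (σ → ℂ) → Matrix ι κ ℂ} (hf : IsPolyFun f)
    (hB : IsPolyMat B) : IsPolyMat fun x => f x • B x := fun i j => hf.mul (hB i j)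

theorem mul [Fintype κ] {A : (σ → ℂ) → Matrix ι κ ℂ} {B : (σ → ℂ) → Matrix κ l ℂ} (hA : IsPolyMat A)
    (hB : IsPolyMat B) : IsPolyMat fun x => A x * B x :=
  fun i j => IsPolyFun.sum _ fun s => (hA i s).mul (hB s j)

theorem det [Fintype κ] [DecidableEq κ] {A : (σ → ℂ) → Matrix κ κ ℂ} (hA : IsPolyMat A) :
    IsPolyFun fun x => (A x).det := by
  simp only [Matrix.det_apply']
  exact IsPolyFun.sum _ fun s => (IsPolyFun.const _).mul (IsPolyFun.prod _ fun i => hA _ _)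

theorem adjugate [Fintype κ] [DecidableEq κ] {A : (σ → ℂ) → Matrix κ κ ℂ} (hA : IsPolyMat A) :
    IsPolyMat fun x => (A x).adjugate := by
  intro i j
  simp only [Matrix.adjugate_apply]
  refine det fun r c => ?_
  by_cases h : r = j
  · subst h
    simpa using IsPolyFun.const _
  · simpa [Matrix.updateRow_ne h] using hA r c

end IsPolyMat

/-! ### Closures -/

theorem isClosed_zariski_iff {σ : Type} {Z : Set (σ → ℂ)} :
    IsClosed[zariski σ] Z ↔ ∃ I : Ideal (MvPolynomial σ ℂ), Z = MvPolynomial.zeroLocus ℂ I := by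
  rw [← @isOpen_compl_iff _ _ (zariski σ)]
  change Zᶜᶜ ∈ _ ↔ _
  rw [compl_compl]
  rfl

theorem isClosed_zariski_setOf {σ : Type} {ι : Sort*} {f : ι → (σ → ℂ) → ℂ}
    (hf : ∀ i, IsPolyFun (f i)) : IsClosed[zariski σ] {x | ∀ i, f i x = 0} := by
  choose p hp using hf
  rw [isClosed_zariski_iff]
  refine ⟨Ideal.span (Set.range p), ?_⟩
  rw [MvPolynomial.zeroLocus_span]
  ext x
  simp only [Set.mem_ofPred_eq, Set.forall_mem_range, hp]

theorem mem_closure_zariski_iff {σ : Type} {A : Set (σ → ℂ)} {x : σ → ℂ} :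
    x ∈ closure[zariski σ] A ↔
      ∀ f, IsPolyFun f → (∀ a ∈ A, f a = 0) → f x = 0 := by
  let _ := zariski σ
  constructor
  · intro hx f hf hA
    have hcl : IsClosed {x | ∀ _ : Unit, f x = 0} := isClosed_zariski_setOf fun _ => hf
    exact closure_minimal (fun a ha _ => hA a ha) hcl hx ()
  · intro h
    obtain ⟨I, hI⟩ := isClosed_zariski_iff.1 (isClosed_closure (s := A))
    rw [hI, MvPolynomial.mem_zeroLocus_iff]
    intro p hp
    refine h _ ⟨p, fun _ => rfl⟩ fun a ha => ?_
    have : a ∈ MvPolynomial.zeroLocus ℂ I := hI ▸ subset_closure ha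
    exact MvPolynomial.mem_zeroLocus_iff.1 this p hp

/-- The entries of a matrix, as a point of affine space. -/
def entries (X : Matrix (Fin n) (Fin n) ℂ) : Fin n × Fin n → ℂ := fun p => X p.1 p.2

theorem mem_closure_sqZeroUpper_iff {A : Set (SqZeroUpper n)} {X : SqZeroUpper n} :
    X ∈ closure A ↔ ∀ f, IsPolyFun f → (∀ Y ∈ A, f (entries Y.1) = 0) → f (entries X.1) = 0 := by
  let _ := zariski (Fin n × Fin n)
  rw [closure_induced, mem_closure_zariski_iff]
  simp only [Set.forall_mem_image]
  rfl

section Pairs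

variable {k m : ℕ}

/-- The entries of a pair of matrices, as a point of affine space. -/
def pairEntries (F : Matrix (Fin n) (Fin k) ℂ) (F' : Matrix (Fin n) (Fin m) ℂ) :
    (Fin n × Fin k) ⊕ (Fin n × Fin m) → ℂ :=
  Sum.elim (fun p => F p.1 p.2) (fun p => F' p.1 p.2)

theorem IsPolyFun.comp_pairEntries {σ : Type}
    {f : ((Fin n × Fin k) ⊕ (Fin n × Fin m) → ℂ) → ℂ} (hf : IsPolyFun f)
    {A : (σ → ℂ) → Matrix (Fin n) (Fin k) ℂ} {B : (σ → ℂ) → Matrix (Fin n) (Fin m) ℂ}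
    (hA : IsPolyMat A) (hB : IsPolyMat B) : IsPolyFun fun x => f (pairEntries (A x) (B x)) := by
  obtain ⟨p, hp⟩ := hf
  simp only [← hp]
  refine IsPolyFun.comp p (f := fun t x => pairEntries (A x) (B x) t) ?_
  rintro (t | t)
  exacts [hA _ _, hB _ _]

theorem IsPolyFun.comp_entries {σ : Type} {f : (Fin n × Fin n → ℂ) → ℂ} (hf : IsPolyFun f)
    {A : (σ → ℂ) → Matrix (Fin n) (Fin n) ℂ} (hA : IsPolyMat A) :
    IsPolyFun fun x => f (entries (A x)) := by
  obtain ⟨p, hp⟩ := hf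
  simp only [← hp]
  exact IsPolyFun.comp p (f := fun t x => entries (A x) t) fun t => hA _ _

/-- Continuity of the quotient map: the closure of the preimage lies in the preimage of the closure.
-/
theorem span_mem_closure {A : Set (Gr k n × Gr m n)} {F : Frame k n} {F' : Frame m n}
    (h : ∀ f, IsPolyFun f → (∀ (E : Frame k n) (E' : Frame m n), (E.span, E'.span) ∈ A →
      f (pairEntries E.1 E'.1) = 0) → f (pairEntries F.1 F'.1) = 0) :
    (F.span, F'.span) ∈ closure[grTopology k m n] A := by
  let π : Frame k n × Frame m n → Gr k n × Gr m n := fun F => (F.1.span, F.2.span)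
  have hcl : IsClosed[frameTopology k m n] (π ⁻¹' closure[grTopology k m n] A) :=
    isClosed_coinduced.1 (@isClosed_closure _ (grTopology k m n) A)
  have hmem : (F, F') ∈ closure[frameTopology k m n] (π ⁻¹' A) := by
    refine (@closure_induced _ _ (zariski _) _ _ _).2 (mem_closure_zariski_iff.2 ?_)
    intro f hf hA
    exact h f hf fun E E' hE => hA _ ⟨(E, E'), hE, rfl⟩
  exact @closure_minimal _ (frameTopology k m n) _ _
    (Set.preimage_mono (@subset_closure _ (grTopology k m n) A)) hcl (F, F') hmem

/-- The polynomial need not be invariant under change of bases, since it is required to vanish on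
every frame over `A`. The points all of whose frames are zeros of `f` form a closed set. -/
theorem eq_zero_of_mem_closure {A : Set (Gr k n × Gr m n)}
    {f : ((Fin n × Fin k) ⊕ (Fin n × Fin m) → ℂ) → ℂ} (hf : IsPolyFun f)
    (hA : ∀ (E : Frame k n) (E' : Frame m n), (E.span, E'.span) ∈ A →
      f (pairEntries E.1 E'.1) = 0)
    {F : Frame k n} {F' : Frame m n} (h : (F.span, F'.span) ∈ closure[grTopology k m n] A) :
    f (pairEntries F.1 F'.1) = 0 := by
  let T : Set (Gr k n × Gr m n) := {x | ∀ (E : Frame k n) (E' : Frame m n), (E.span, E'.span) = x →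
    f (pairEntries E.1 E'.1) = 0}
  have hT : IsClosed[grTopology k m n] T := by
    let _ := frameTopology k m n
    refine isClosed_coinduced.2 ?_
    let _ := zariski ((Fin n × Fin k) ⊕ (Fin n × Fin m))
    -- Any two frames of a point differ by invertible matrices, so the preimage is cut out by the
    -- polynomials obtained from `f` by all constant changes of bases.
    refine isClosed_induced_iff.2 ⟨{x | ∀ p : GL (Fin k) ℂ × GL (Fin m) ℂ,
      f (pairEntries ((Matrix.of fun i j => x (Sum.inl (i, j))) * p.1.1)
        ((Matrix.of fun i j => x (Sum.inr (i, j))) * p.2.1)) = 0},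
      isClosed_zariski_setOf fun p => hf.comp_pairEntries
        (IsPolyMat.mul (fun i j => IsPolyFun.coord _) (IsPolyMat.const _))
        (IsPolyMat.mul (fun i j => IsPolyFun.coord _) (IsPolyMat.const _)), ?_⟩
    ext E
    constructor
    · intro hE D D' hD
      obtain ⟨a, ha⟩ := Frame.exists_eq_mul_of_span_eq (congrArg Prod.fst hD).symm
      obtain ⟨c, hc⟩ := Frame.exists_eq_mul_of_span_eq (congrArg Prod.snd hD).symm
      rw [ha, hc]
      exact hE (a, c)
    · rintro hE ⟨a, c⟩
      exact hE (E.1.rebase a) (E.2.rebase c)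
        (Prod.ext (Frame.span_eq_of_eq_mul a.1 rfl).symm (Frame.span_eq_of_eq_mul c.1 rfl).symm)
  have hAT : A ⊆ T := by
    rintro x hx E E' rfl
    exact hA E E' hx
  exact @closure_minimal _ (grTopology k m n) _ _ hAT hT _ h F F' rfl

end Pairs

/-! ### Comparison of orbit closures -/

theorem swCount_le_of_mem_closure {v w : involutions n}
    (h : upperPart v ∈ closure (adjointOrbit w)) (i j : ℕ) :
    swCount (upperPart v).1 i j ≤ swCount (upperPart w).1 i j := by
  refine (isRook_upperPart v).swCount_le fun ι h1 h2 hc => ?_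
  refine mem_closure_sqZeroUpper_iff.1 h
    (fun x => ((Matrix.of fun a b => x (a, b)).submatrix (fun s : ι => s.1.1)
      (fun s : ι => s.1.2)).det) (IsPolyMat.det fun a b => IsPolyFun.coord _) ?_
  rintro Y ⟨g, hg, hY⟩
  change (Y.1.submatrix _ _).det = 0
  rw [hY]
  exact det_submatrix_eq_zero hg (inv_mem hg) (fun s => h1 s.1 s.2) (fun s => h2 s.1 s.2)
    (by simpa using hc)

theorem upperPart_mem_adjointOrbit (w : involutions n) : upperPart w ∈ adjointOrbit w :=
  ⟨1, one_mem _, by simp⟩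

theorem adjointLE_antisymm {v w : involutions n} (h1 : adjointLE v w) (h2 : adjointLE w v) :
    v = w :=
  upperPart_injective <| (isRook_upperPart v).ext (isRook_upperPart w)
    (swCount_le_of_mem_closure (h1 (upperPart_mem_adjointOrbit v)))
    (swCount_le_of_mem_closure (h2 (upperPart_mem_adjointOrbit w)))

/-- Since `w_< = P_I w_< P_J`, compressing `g w_< g⁻¹` to `I × J` only sees the diagonal blocks of
`g` on `I` and of `g⁻¹` on `J`. Completed by the identity, these are the required row and column
operations. -/
theorem exists_rookEquiv_of_mem_adjointOrbit {I J : Finset (Fin n)} (hIJ : Disjoint I J)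
    {w : involutions n} (hw : ArcsIn I J w) {X : SqZeroUpper n} (hX : X ∈ adjointOrbit w) :
    ∃ Y : SqZeroUpper n, Y.1 = coordProj I * X.1 * coordProj J ∧ RookEquiv I J Y.1 w := by
  obtain ⟨g, hg, hgX⟩ := hX
  have hstrict : ∀ i j, j ≤ i → (coordProj I * X.1 * coordProj J) i j = 0 := fun i j h => by
    rw [mul_coordProj_apply, coordProj_mul_apply, X.2.1 i j h]
    simp
  have hsq : coordProj I * X.1 * coordProj J * (coordProj I * X.1 * coordProj J) = 0 := by
    have h0 : coordProj J * coordProj I = 0 := by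
      rw [coordProj_mul_coordProj, Finset.inter_comm, Finset.disjoint_iff_inter_eq_empty.1 hIJ,
        coordProj_empty]
    calc _ = coordProj I * X.1 * (coordProj J * coordProj I) * X.1 * coordProj J := by
          simp only [mul_assoc]
      _ = 0 := by rw [h0]; simp
  have tri : ∀ (S : Finset (Fin n)) (x : GL (Fin n) ℂ), x ∈ borel n →
      let Z := coordProj S * x.1 * coordProj S + coordProj Sᶜ
      Z.BlockTriangular id ∧ (∀ i, Z i i ≠ 0) ∧
        ∀ i j, Z i j ≠ (1 : Matrix (Fin n) (Fin n) ℂ) i j → i ∈ S ∧ j ∈ S := by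
    intro S x hx
    refine ⟨(((coordProj_blockTriangular S).mul ((mem_borel_iff x).1 hx)).mul
      (coordProj_blockTriangular S)).add (coordProj_blockTriangular Sᶜ), fun i => ?_,
      fun i j h => ?_⟩
    · rw [Matrix.add_apply, mul_coordProj_apply, coordProj_mul_apply, coordProj_apply_self]
      by_cases hi : i ∈ S <;> simp [hi, diag_ne_zero_of_mem_borel hx]
    · by_contra hc
      apply h
      rw [Matrix.add_apply, mul_coordProj_apply, coordProj_mul_apply]
      have : (if j ∈ S then if i ∈ S then x.1 i j else 0 else 0) = 0 := by
        split_ifs <;> tauto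
      rw [this, zero_add, coordProj, Matrix.diagonal_apply, Matrix.one_apply]
      by_cases hij : i = j
      · subst hij
        have : i ∉ S := fun h => hc ⟨h, h⟩
        simp [this]
      · simp [hij]
  obtain ⟨hG1, hG2, hG3⟩ := tri I g hg
  obtain ⟨hH1, hH2, hH3⟩ := tri J g⁻¹ (inv_mem hg)
  refine ⟨⟨_, hstrict, hsq⟩, rfl, _, _, hG1, hH1, hG2, hH2, hG3, hH3, ?_⟩
  have hIw : coordProj I * (upperPart w).1 = (upperPart w).1 :=
    (coordProj_mul_eq_self_iff _ _).2 fun i j h => (hw.of_upperPart_ne_zero h).1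
  have hwJ : (upperPart w).1 * coordProj J = (upperPart w).1 :=
    (mul_coordProj_eq_self_iff _ _).2 fun i j h => (hw.of_upperPart_ne_zero h).2
  have e1 : (coordProj I * g.1 * coordProj I + coordProj Iᶜ) * (upperPart w).1 =
      coordProj I * g.1 * (upperPart w).1 := by
    rw [add_mul, mul_assoc (coordProj I * g.1), hIw, coordProj_compl, sub_mul, hIw]
    simp
  have e2 : (upperPart w).1 * (coordProj J * (g⁻¹).1 * coordProj J + coordProj Jᶜ) =
      (upperPart w).1 * (g⁻¹).1 * coordProj J := by
    rw [mul_add, ← mul_assoc, ← mul_assoc, hwJ, coordProj_compl, mul_sub, hwJ]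
    simp
  change coordProj I * X.1 * coordProj J = _
  rw [e1, mul_assoc (coordProj I * g.1), e2, hgX]
  simp only [mul_assoc]

section Comparison

variable {k m : ℕ} {L M : Finset (Fin n)} (hL : L.card = k) (hM : M.card = m)

theorem orbit_subset_closure_of_mem_closure {v w : involutions n} (hv : ArcsIn (L ∪ M)ᶜ (L ∩ M) v)
    (hw : ArcsIn (L ∪ M)ᶜ (L ∩ M) w) (h : upperPart v ∈ closure (adjointOrbit w)) :
    MulAction.orbit (borel n) (pairPoint hL hM (upperPart v)) ⊆ closure[grTopology k m n]
      (MulAction.orbit (borel n) (pairPoint hL hM (upperPart w))) := by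
  rintro _ ⟨⟨g, hg⟩, rfl⟩
  have key : ∀ X : SqZeroUpper n, (⟨g, hg⟩ : borel n) • pairPoint hL hM X =
      (((coordFrame hL).smul (g * oneAdd X)).span, ((coordFrame hM).smul g).span) := by
    intro X
    rw [Frame.span_smul, Frame.span_smul, mul_smul]
    rfl
  change (⟨g, hg⟩ : borel n) • pairPoint hL hM (upperPart v) ∈ _
  rw [key]
  refine span_mem_closure fun f hf hA => ?_
  let I : Finset (Fin n) := (L ∪ M)ᶜ
  let J : Finset (Fin n) := L ∩ M
  -- The compression to `I × J` is built into the polynomial: an arbitrary element of `B · w_<` need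
  -- not be supported there, but its compression still gives a pair in the orbit of `w`.
  have hpoly : IsPolyFun fun x : Fin n × Fin n → ℂ => f (pairEntries
      (g.1 * (1 + coordProj I * (Matrix.of fun a b => x (a, b)) * coordProj J) * (sel hL)ᵀ)
      (g.1 * (sel hM)ᵀ)) :=
    hf.comp_pairEntries
      (((IsPolyMat.const _).mul ((IsPolyMat.const _).add
        (((IsPolyMat.const _).mul fun a b => IsPolyFun.coord _).mul (IsPolyMat.const _)))).mul
        (IsPolyMat.const _)) (IsPolyMat.const _)
  have := mem_closure_sqZeroUpper_iff.1 h _ hpoly (by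
    intro X hX
    obtain ⟨Y, hY, hr⟩ := exists_rookEquiv_of_mem_adjointOrbit (disjoint_compl_union_inter L M)
      hw hX
    have horb := (hr.mem_orbits hL hM hw).2
    change f (pairEntries (g.1 * (1 + coordProj I * X.1 * coordProj J) * (sel hL)ᵀ) _) = 0
    rw [← hY]
    refine hA ((coordFrame hL).smul (g * oneAdd Y)) ((coordFrame hM).smul g) ?_
    rw [← key, ← MulAction.orbit_eq_iff.2 horb]
    exact MulAction.mem_orbit _ _)
  have e : coordProj I * (upperPart v).1 * coordProj J = (upperPart v).1 := by
    rw [(coordProj_mul_eq_self_iff _ _).2 fun i j h => (hv.of_upperPart_ne_zero h).1,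
      (mul_coordProj_eq_self_iff _ _).2 fun i j h => (hv.of_upperPart_ne_zero h).2]
  change f (pairEntries (g.1 * (1 + coordProj I * (upperPart v).1 * coordProj J) * (sel hL)ᵀ) _)
    = 0 at this
  rw [e] at this
  exact this

/-! ### From pairs of frames back to square zero matrices -/

/-- The polynomial map sending a pair of frames to a multiple of a Schur complement of the matrix
of the projection along the second subspace, restricted to the first one. -/
def schurMap (F : Matrix (Fin n) (Fin k) ℂ) (F' : Matrix (Fin n) (Fin m) ℂ) :
    Matrix (Fin n) (Fin n) ℂ :=
  -- With `P = F (sel_L F)⁻¹ sel_L` and `Q` formed likewise from `F'` and `M`, this is `(1 - Q) P`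
  -- times the two determinants. Below, `D.adjugate` similarly replaces the inverse of the block on
  -- `L \ M`.
  let C := ((sel hM * F').det • 1 - F' * (sel hM * F').adjugate * sel hM) *
    (F * (sel hL * F).adjugate * sel hL)
  let D := coordProj (L \ M) * C * coordProj (L \ M) + (1 - coordProj (L \ M))
  D.det • C - C * (coordProj (L \ M) * D.adjugate * coordProj (L \ M)) * C

theorem isPolyMat_schurMap {σ : Type} {A : (σ → ℂ) → Matrix (Fin n) (Fin k) ℂ}
    {B : (σ → ℂ) → Matrix (Fin n) (Fin m) ℂ} (hA : IsPolyMat A) (hB : IsPolyMat B) :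
    IsPolyMat fun x => schurMap hL hM (A x) (B x) := by
  have hc : ∀ {ι κ : Type} (X : Matrix ι κ ℂ), IsPolyMat fun _ : σ → ℂ => X :=
    fun X => IsPolyMat.const X
  have hC := ((IsPolyMat.smul ((hc (sel hM)).mul hB).det (hc 1)).sub
    ((hB.mul ((hc (sel hM)).mul hB).adjugate).mul (hc (sel hM)))).mul
    ((hA.mul ((hc (sel hL)).mul hA).adjugate).mul (hc (sel hL)))
  have hD := (((hc (coordProj (L \ M))).mul hC).mul (hc (coordProj (L \ M)))).add
    (hc (1 - coordProj (L \ M)))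
  exact (IsPolyMat.smul hD.det hC).sub ((hC.mul (((hc (coordProj (L \ M))).mul hD.adjugate).mul
    (hc (coordProj (L \ M))))).mul hC)

end Comparison

/-- The torus element with `c` at the left endpoints of arcs and `1` elsewhere conjugates `w_<` to
`c • w_<`. This absorbs the scalar created by clearing denominators. -/
theorem smul_mem_adjointOrbit {w : involutions n} {X : SqZeroUpper n} (hX : X ∈ adjointOrbit w)
    {c : ℂ} (hc : c ≠ 0) : ∃ Y ∈ adjointOrbit w, Y.1 = c • X.1 := by
  obtain ⟨g, hg, hgX⟩ := hX
  obtain ⟨d, hd, hdD⟩ := exists_mem_borel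
    (X := Matrix.diagonal fun i => if i < w.1 i then c else 1)
    (Matrix.blockTriangular_diagonal _) (fun i => by
      rw [Matrix.diagonal_apply_eq]; split_ifs <;> simp [hc])
  have hdw : d.1 * (upperPart w).1 = c • (upperPart w).1 := by
    ext i j
    rw [hdD, Matrix.diagonal_mul, Matrix.smul_apply, upperPart_apply, smul_eq_mul]
    by_cases h : w.1 i = j ∧ i < j
    · rw [if_pos (h.1 ▸ h.2)]
    · simp [if_neg h]
  have hwd : (upperPart w).1 * d.1 = (upperPart w).1 := by
    ext i j
    rw [hdD, Matrix.mul_diagonal, upperPart_apply]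
    by_cases h : w.1 i = j ∧ i < j
    · have : ¬ j < w.1 j := by
        rw [← h.1, involutions_apply_apply, h.1]
        exact h.2.not_gt
      rw [if_neg this, mul_one]
    · simp [if_neg h]
  refine ⟨⟨c • X.1, fun i j h => by rw [Matrix.smul_apply, X.2.1 i j h, smul_zero], by
    rw [Matrix.smul_mul, Matrix.mul_smul, X.2.2, smul_zero, smul_zero]⟩,
    mem_adjointOrbit_of_mul_eq (g := g * d) (mul_mem hg hd) ?_, rfl⟩
  change c • X.1 * (g * d).1 = _
  rw [Units.val_mul, hgX]
  calc _ = c • (g.1 * (upperPart w).1 * ((g⁻¹).1 * g.1) * d.1) := by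
        simp only [Matrix.smul_mul, mul_assoc]
    _ = g.1 * (c • (upperPart w).1) := by
        rw [coe_inv_mul_cancel, mul_one, mul_assoc, hwd, Matrix.mul_smul]
    _ = _ := by rw [← hdw, mul_assoc]

theorem conj_mem_adjointOrbit {w : involutions n} {g : GL (Fin n) ℂ} (hg : g ∈ borel n)
    {Y : SqZeroUpper n} (hY : Y ∈ adjointOrbit w) :
    ∃ Z ∈ adjointOrbit w, Z.1 = g.1 * Y.1 * (g⁻¹).1 := by
  obtain ⟨y, hy, hyY⟩ := hY
  refine ⟨⟨g.1 * Y.1 * (g⁻¹).1, fun i j hij => ?_, ?_⟩, ⟨g * y, mul_mem hg hy, ?_⟩, rfl⟩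
  · have hgY := ((mem_borel_iff g).1 hg).mul (blockTriangular_sqZeroUpper Y)
    have hg' := (mem_borel_iff _).1 (inv_mem hg)
    rcases hij.lt_or_eq with hlt | rfl
    · exact hgY.mul hg' hlt
    · rw [BlockTriangular.mul_diag hgY hg', BlockTriangular.mul_diag ((mem_borel_iff g).1 hg)
        (blockTriangular_sqZeroUpper Y), Y.2.1 j j le_rfl]
      simp
  · calc _ = g.1 * Y.1 * ((g⁻¹).1 * g.1) * Y.1 * (g⁻¹).1 := by simp only [mul_assoc]
      _ = 0 := by rw [coe_inv_mul_cancel, mul_one, mul_assoc g.1, Y.2.2]; simp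
  · change g.1 * Y.1 * (g⁻¹).1 = _
    rw [hyY, mul_inv_rev, Units.val_mul, Units.val_mul]
    simp only [mul_assoc]

section Comparison

variable {k m : ℕ} {L M : Finset (Fin n)} (hL : L.card = k) (hM : M.card = m)

/-- A frame of a subspace in the cell of `L` has a reduced echelon form. -/
theorem exists_echelon {g : GL (Fin n) ℂ} (hg : g ∈ borel n) {F : Frame k n}
    (hF : F.span = g • coordSpace hL) :
    ∃ P : Matrix (Fin n) (Fin n) ℂ, ∃ b ∈ borel n, P * coordProj L = P ∧
      coordProj L * P = coordProj L ∧ b.1 = P + (1 - coordProj L) ∧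
      b • coordSpace hL = F.span ∧ (sel hL * F.1).det ≠ 0 ∧
      F.1 * (sel hL * F.1).adjugate * sel hL = (sel hL * F.1).det • P := by
  -- `P = g K` is the projection onto `g U_L` along the coordinate subspace of `Lᶜ`; it depends only
  -- on the subspace, and any frame recovers it through the adjugate.
  obtain ⟨K, hK, hKe, -, hKg, hgK⟩ := exists_inverse_of_block ((mem_borel_iff g).1 hg) (T := L)
    (fun i _ => diag_ne_zero_of_mem_borel hg i)
  have hPtri : (g.1 * K).BlockTriangular id := ((mem_borel_iff g).1 hg).mul hK
  have hPe : g.1 * K * coordProj L = g.1 * K := by rw [mul_assoc, hKe]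
  have heP : coordProj L * (g.1 * K) = coordProj L := by rw [← mul_assoc, hgK]
  have hPg : g.1 * K * (g.1 * (sel hL)ᵀ) = g.1 * (sel hL)ᵀ := by
    conv_lhs => rw [← coordProj_mul_sel_transpose hL, ← Matrix.mul_assoc, ← Matrix.mul_assoc,
      mul_assoc g.1 K, mul_assoc g.1, hKg, Matrix.mul_assoc, coordProj_mul_sel_transpose]
  generalize g.1 * K = P at hPtri hPe heP hPg
  obtain ⟨b, hb, hbP⟩ := exists_mem_borel (X := P + (1 - coordProj L))
    (hPtri.add (Matrix.blockTriangular_one.sub (coordProj_blockTriangular L))) (by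
      intro i
      rw [← coordProj_compl, Matrix.add_apply, coordProj_apply_self]
      by_cases hi : i ∈ L
      · have := congrFun (congrFun heP i) i
        rw [coordProj_mul_apply, if_pos hi, coordProj_apply_self, if_pos hi] at this
        simp [this, hi]
      · have := congrFun (congrFun hPe i) i
        rw [mul_coordProj_apply, if_neg hi] at this
        simp [← this, hi])
  have hbE : b.1 * (sel hL)ᵀ = P * (sel hL)ᵀ := by
    rw [hbP, Matrix.add_mul, Matrix.sub_mul, Matrix.one_mul, coordProj_mul_sel_transpose,
      sub_self, add_zero]
  have hPs : P = P * (sel hL)ᵀ * sel hL := by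
    rw [Matrix.mul_assoc, transpose_mul_sel, hPe]
  rw [coordSpace, ← Frame.span_smul] at hF
  obtain ⟨a, ha⟩ := Frame.exists_eq_mul_of_span_eq hF.symm
  have hPF : P * F.1 = F.1 := by
    rw [ha, ← Matrix.mul_assoc]
    congr 1
  have hinj : Function.Injective (sel hL * F.1).mulVec := by
    intro x y hxy
    apply F.mulVec_injective
    rw [← hPF, hPs]
    simp only [Matrix.mul_assoc, ← Matrix.mulVec_mulVec] at hxy ⊢
    rw [hxy]
  have hunit := Matrix.mulVec_injective_iff_isUnit.1 hinj
  refine ⟨P, b, hb, hPe, heP, hbP, ?_, ((Matrix.isUnit_iff_isUnit_det _).1 hunit).ne_zero, ?_⟩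
  · rw [hF, coordSpace, ← Frame.span_smul]
    refine Frame.span_eq_of_eq_mul (sel hL * (g.1 * (sel hL)ᵀ)) ?_
    change g.1 * (sel hL)ᵀ = b.1 * (sel hL)ᵀ * _
    rw [hbE, ← Matrix.mul_assoc, ← hPs, hPg]
  · calc F.1 * (sel hL * F.1).adjugate * sel hL
        = P * (sel hL)ᵀ * sel hL * F.1 * (sel hL * F.1).adjugate * sel hL := by rw [← hPs, hPF]
      _ = P * (sel hL)ᵀ * (sel hL * F.1 * (sel hL * F.1).adjugate) * sel hL := by
        simp only [Matrix.mul_assoc]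
      _ = _ := by
        rw [Matrix.mul_adjugate, Matrix.mul_smul, Matrix.mul_one, Matrix.smul_mul, ← hPs]

/-- Echelon representatives `b`, `c` of the two subspaces satisfy `P_{Mᶜ} c⁻¹ b P_L = (1 - Q) P`. So
`schurMap` is a nonzero multiple of the matrix `X` from the normal form of the pair. Hence `X` lies
in the orbit of some involution `u`, and separation of orbits forces `u = w`. -/
theorem schurMap_mem_adjointOrbit {w : involutions n} (hw : ArcsIn (L ∪ M)ᶜ (L ∩ M) w)
    {F : Frame k n} {F' : Frame m n} (h : (F.span, F'.span) ∈
      MulAction.orbit (borel n) (pairPoint hL hM (upperPart w))) :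
    ∃ X ∈ adjointOrbit w, X.1 = schurMap hL hM F.1 F'.1 := by
  obtain ⟨⟨g, hg⟩, hgF⟩ := h
  have h1 : F.span = (g * oneAdd (upperPart w)) • coordSpace hL := by
    rw [mul_smul]
    exact (congrArg Prod.fst hgF).symm
  have h2 : F'.span = g • coordSpace hM := (congrArg Prod.snd hgF).symm
  obtain ⟨P, b, hb, hPe, heP, hbP, hbF, hd1, hP⟩ :=
    exists_echelon hL (mul_mem hg (oneAdd_mem_borel _)) h1
  obtain ⟨Q, c, hc, hQe, heQ, hcQ, hcF, hd2, hQ⟩ := exists_echelon hM hg h2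
  have hcb : c⁻¹ * b ∈ borel n := mul_mem (inv_mem hc) hb
  have hQc : coordProj Mᶜ * (c⁻¹).1 = 1 - Q := by
    have hQQ : Q * Q = Q := by
      calc Q * Q = Q * (coordProj M * Q) := by rw [← mul_assoc, hQe]
        _ = Q := by rw [heQ, hQe]
    have : (1 - Q) * c.1 = coordProj Mᶜ := by
      rw [hcQ, coordProj_compl, sub_mul, one_mul, mul_add, mul_sub, hQQ, hQe, mul_one]
      abel
    rw [← this, mul_assoc, coe_mul_inv_cancel, mul_one]
  have hbE : b.1 * coordProj L = P := by
    rw [hbP, add_mul, sub_mul, hPe, one_mul, coordProj_mul_coordProj, Finset.inter_self, sub_self,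
      add_zero]
  have hC : coordProj Mᶜ * (c⁻¹ * b).1 * coordProj L = (1 - Q) * P := by
    rw [Units.val_mul, ← mul_assoc, hQc, mul_assoc, hbE]
  set C := (1 - Q) * P with hCdef
  set d1 := (sel hL * F.1).det
  set d2 := (sel hM * F'.1).det
  set e := coordProj (L \ M) with he
  have hee : e * e = e := by rw [he, coordProj_mul_coordProj, Finset.inter_self]
  set D := e * ((d2 * d1) • C) * e + (1 - e) with hD
  have hS : schurMap hL hM F.1 F'.1 = D.det • ((d2 * d1) • C) -
      ((d2 * d1) • C) * (e * D.adjugate * e) * ((d2 * d1) • C) := by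
    have : (d2 • 1 - F'.1 * (sel hM * F'.1).adjugate * sel hM) *
        (F.1 * (sel hL * F.1).adjugate * sel hL) = (d2 * d1) • C := by
      rw [hP, hQ, ← smul_sub, Matrix.smul_mul, Matrix.mul_smul, smul_smul]
    simp only [schurMap]
    rw [this]
  have hDdet : D.det ≠ 0 := by
    have hCtri : C.BlockTriangular id := by
      rw [← hC]
      exact ((coordProj_blockTriangular _).mul ((mem_borel_iff _).1 hcb)).mul
        (coordProj_blockTriangular _)
    have hetri : e.BlockTriangular id := coordProj_blockTriangular _
    have hCs : ((d2 * d1) • C).BlockTriangular id := fun i j hij => by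
      rw [Matrix.smul_apply, hCtri hij, smul_zero]
    have hDtri : D.BlockTriangular id :=
      ((hetri.mul hCs).mul hetri).add (Matrix.blockTriangular_one.sub hetri)
    rw [Matrix.det_of_isUpperTriangular hDtri, Finset.prod_ne_zero_iff]
    intro i _
    rw [hD, Matrix.add_apply, he, mul_coordProj_apply, coordProj_mul_apply, ← coordProj_compl,
      coordProj_apply_self]
    by_cases hi : i ∈ L \ M
    · rw [if_pos hi, if_pos hi, if_neg (by simpa using hi), add_zero, Matrix.smul_apply, ← hC]
      rw [Finset.mem_sdiff] at hi
      rw [mul_coordProj_apply, coordProj_mul_apply, if_pos hi.1, if_pos (Finset.mem_compl.2 hi.2)]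
      exact smul_ne_zero (mul_ne_zero hd2 hd1) (diag_ne_zero_of_mem_borel hcb i)
    · rw [if_neg hi, if_pos (Finset.mem_compl.2 hi)]
      simp
  have hDe : e * ((d2 * d1) • C) * e = D * e := by
    rw [hD, add_mul, sub_mul, one_mul, hee, sub_self, add_zero, mul_assoc _ e e, hee]
  -- The adjugate of `D` inverts the block of `(d2 * d1) • C`; the factor `d2 * d1` converts this
  -- into the inverse for `C` itself.
  obtain ⟨u, hu, huorb, X, hX, hXC⟩ := exists_involution_of_mem_borel hL hM hcb hC
    (K := ((d2 * d1) * D.det⁻¹) • (e * D.adjugate * e)) (by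
      rw [Matrix.smul_mul, mul_assoc _ e e, hee]) (by
      calc _ = D.det⁻¹ • (e * D.adjugate * (e * ((d2 * d1) • C) * e)) := by
            simp only [Matrix.smul_mul, Matrix.mul_smul, smul_smul, mul_assoc]
            rw [← he]
            congr 1
            ring
        _ = e := by
          rw [hDe, ← mul_assoc, mul_assoc e, Matrix.adjugate_mul, Matrix.mul_smul, mul_one,
            Matrix.smul_mul, hee, smul_smul, inv_mul_cancel₀ hDdet, one_smul])
  have huw : u = w := by
    refine eq_of_mem_orbit hL hM hu hw (MulAction.orbit_eq_iff.1 ?_)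
    rw [← MulAction.orbit_eq_iff.2 huorb, eq_comm, MulAction.orbit_eq_iff]
    refine ⟨⟨g⁻¹ * c, mul_mem (inv_mem hg) hc⟩, Prod.ext ?_ ?_⟩
    · change (g⁻¹ * c) • (c⁻¹ * b) • coordSpace hL = oneAdd (upperPart w) • coordSpace hL
      rw [mul_smul, smul_smul c, mul_inv_cancel_left, hbF, h1, mul_smul, inv_smul_smul]
    · change (g⁻¹ * c) • coordSpace hM = coordSpace hM
      rw [mul_smul, hcF, h2, inv_smul_smul]
  subst huw
  obtain ⟨Y, hY, hYX⟩ := smul_mem_adjointOrbit hX (c := D.det * (d2 * d1))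
    (mul_ne_zero hDdet (mul_ne_zero hd2 hd1))
  refine ⟨Y, hY, ?_⟩
  rw [hYX, hXC, hS, smul_sub]
  simp only [Matrix.smul_mul, Matrix.mul_smul, smul_smul]
  congr 2
  field_simp

/-- For the standard frames all determinants are `1` and `C = v_< + P_{L \ M}`, so the Schur
complement removes exactly the diagonal block. -/
theorem schurMap_upperPart {v : involutions n} (hv : ArcsIn (L ∪ M)ᶜ (L ∩ M) v) :
    schurMap hL hM ((1 + (upperPart v).1) * (sel hL)ᵀ) (sel hM)ᵀ = (upperPart v).1 := by
  have hLv : coordProj L * (upperPart v).1 = 0 := by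
    ext i j
    rw [coordProj_mul_apply]
    split_ifs with hi
    · by_contra h
      exact Finset.mem_compl.1 (hv.of_upperPart_ne_zero h).1 (Finset.mem_union_left _ hi)
    · rfl
  have h1 : sel hL * ((1 + (upperPart v).1) * (sel hL)ᵀ) = 1 := by
    rw [← sel_mul_coordProj, ← Matrix.mul_assoc, Matrix.mul_assoc (sel hL), mul_add, hLv, mul_one,
      add_zero, sel_mul_coordProj, sel_mul_transpose]
  have hee : coordProj (L \ M) * coordProj (L \ M) = coordProj (L \ M) := by
    rw [coordProj_mul_coordProj, Finset.inter_self]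
  have hev : coordProj (L \ M) * (upperPart v).1 = 0 := by
    have : coordProj (L \ M) * coordProj L = coordProj (L \ M) := by
      rw [coordProj_mul_coordProj]; congr 1; ext; simp; tauto
    rw [← this, mul_assoc, hLv, mul_zero]
  have hve : (upperPart v).1 * coordProj (L \ M) = 0 := by
    ext i j
    rw [mul_coordProj_apply]
    split_ifs with hj
    · by_contra h
      exact (Finset.mem_sdiff.1 hj).2 (Finset.mem_inter.1 (hv.of_upperPart_ne_zero h).2).2
    · rfl
  have hC : (1 - (sel hM)ᵀ * sel hM) * ((1 + (upperPart v).1) * (sel hL)ᵀ * sel hL) =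
      (upperPart v).1 + coordProj (L \ M) := by
    rw [Matrix.mul_assoc _ (sel hL)ᵀ, transpose_mul_sel, transpose_mul_sel, ← coordProj_compl,
      ← mul_assoc, coordProj_mul_oneAdd_mul_coordProj hv]
  simp only [schurMap, h1, sel_mul_transpose, Matrix.det_one, one_smul, Matrix.adjugate_one,
    Matrix.mul_one, hC]
  have hD : coordProj (L \ M) * ((upperPart v).1 + coordProj (L \ M)) * coordProj (L \ M) +
      (1 - coordProj (L \ M)) = 1 := by
    rw [mul_add, hev, zero_add, hee, hee]; abel
  rw [hD, Matrix.det_one, one_smul, Matrix.adjugate_one, mul_one, hee, add_mul, hve, zero_add, hee,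
    mul_add, hev, zero_add, hee, add_sub_cancel_right]

theorem adjointLE_of_mem_closure {v w : involutions n} (hv : ArcsIn (L ∪ M)ᶜ (L ∩ M) v)
    (hw : ArcsIn (L ∪ M)ᶜ (L ∩ M) w)
    (h : pairPoint hL hM (upperPart v) ∈ closure[grTopology k m n]
      (MulAction.orbit (borel n) (pairPoint hL hM (upperPart w)))) : adjointLE v w := by
  rintro X ⟨g, hg, hgX⟩
  rw [mem_closure_sqZeroUpper_iff]
  intro f hf hA
  have hspan : pairPoint hL hM (upperPart v) =
      (((coordFrame hL).smul (oneAdd (upperPart v))).span, (coordFrame hM).span) := by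
    rw [Frame.span_smul]
    rfl
  rw [hspan] at h
  -- Conjugation by the fixed `g` is included so that the value at the standard frames of `v` is the
  -- given point `X` of `B · v_<`.
  let G := fun x : (Fin n × Fin k) ⊕ (Fin n × Fin m) → ℂ =>
    f (entries (g.1 * schurMap hL hM (Matrix.of fun i j => x (Sum.inl (i, j)))
      (Matrix.of fun i j => x (Sum.inr (i, j))) * (g⁻¹).1))
  have hG : IsPolyFun G := hf.comp_entries (((IsPolyMat.const _).mul
    (isPolyMat_schurMap hL hM (fun i j => IsPolyFun.coord _) (fun i j => IsPolyFun.coord _))).mul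
      (IsPolyMat.const _))
  have hGE : ∀ E E', G (pairEntries E E') = f (entries (g.1 * schurMap hL hM E E' * (g⁻¹).1)) :=
    fun _ _ => rfl
  have hvan : ∀ (E : Frame k n) (E' : Frame m n), (E.span, E'.span) ∈
      MulAction.orbit (borel n) (pairPoint hL hM (upperPart w)) → G (pairEntries E.1 E'.1) = 0 := by
    intro E E' hE
    obtain ⟨Y, hY, hYS⟩ := schurMap_mem_adjointOrbit hL hM hw hE
    obtain ⟨Z, hZ, hZY⟩ := conj_mem_adjointOrbit hg hY
    rw [hGE, ← hYS, ← hZY]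
    exact hA Z hZ
  have := eq_zero_of_mem_closure hG hvan h
  have hF : ((coordFrame hL).smul (oneAdd (upperPart v))).1 =
      (1 + (upperPart v).1) * (sel hL)ᵀ := rfl
  have hF' : (coordFrame hM).1 = (sel hM)ᵀ := rfl
  rw [hGE, hF, hF', schurMap_upperPart hL hM hv, ← hgX] at this
  exact this

end Comparison

/-! ### Consistent involutions -/

section Consistent

variable {k m : ℕ} {lam mu : YoungDiagram}

/-- The positions of the ones in the bit string of `lam`. -/
def bitSet (k n : ℕ) (lam : YoungDiagram) : Finset (Fin n) :=
  Finset.univ.filter fun j => bit k n lam j = 1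

theorem mem_bitSet {j : Fin n} : j ∈ bitSet k n lam ↔ bit k n lam j = 1 := by
  simp [bitSet]

theorem card_bitSet (h : Fits k n lam) : (bitSet k n lam).card = k := by
  refine Eq.trans ?_ (ncard_bit h)
  rw [Set.ncard_eq_toFinset_card']
  congr 1
  ext j
  simp [bitSet]

theorem coordPoint_eq (h : Fits k n lam) : coordPoint h = coordSpace (card_bitSet h) :=
  coordPoint_eq_coordSpace h (card_bitSet h)

theorem bit_eq_zero_or_one (k : ℕ) (lam : YoungDiagram) (j : Fin n) :
    bit k n lam j = 0 ∨ bit k n lam j = 1 := by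
  unfold bit
  split_ifs <;> simp

theorem bitSum_iff {i : Fin n} : (bitSum k m n lam mu i = 0 ↔
    i ∈ (bitSet k n lam ∪ bitSet m n mu)ᶜ) ∧
    (bitSum k m n lam mu i = 2 ↔ i ∈ bitSet k n lam ∩ bitSet m n mu) := by
  simp only [bitSum, Finset.mem_compl, Finset.mem_union, Finset.mem_inter, mem_bitSet]
  rcases bit_eq_zero_or_one k lam i with h | h <;>
    rcases bit_eq_zero_or_one m mu i with h' | h' <;> simp [h, h']

theorem mem_consistent_iff {w : involutions n} : w.1 ∈ consistent k m n lam mu ↔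
    ArcsIn (bitSet k n lam ∪ bitSet m n mu)ᶜ (bitSet k n lam ∩ bitSet m n mu) w := by
  constructor
  · intro h i j hij hw
    have := h.2 i j hij hw (by rw [← hw, involutions_apply_apply])
    exact ⟨bitSum_iff.1.1 this.1, bitSum_iff.2.1 this.2⟩
  · intro h
    refine ⟨w.2, fun i j hij hw _ => ?_⟩
    have := h i j hij hw
    exact ⟨bitSum_iff.1.2 this.1, bitSum_iff.2.2 this.2⟩

theorem arcsIn_toInvolution (w : consistent k m n lam mu) :
    ArcsIn (bitSet k n lam ∪ bitSet m n mu)ᶜ (bitSet k n lam ∩ bitSet m n mu) (toInvolution w) :=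
  mem_consistent_iff.1 w.2

/-- A moved `j` with bit `1` cannot be a left endpoint, so its arc has `w j < j` and is recorded in
column `j` of `w_<`. -/
theorem oneAdd_mulVec_stdVec (w : consistent k m n lam mu) {j : Fin n}
    (hj : bit k n lam j = 1) :
    (oneAdd (upperPart (toInvolution w))).1 *ᵥ stdVec j = arcVec w.1 j := by
  have hw := arcsIn_toInvolution w
  ext i
  rw [coe_oneAdd, Matrix.add_mulVec, Matrix.one_mulVec, stdVec, Matrix.mulVec_single_one,
    Pi.add_apply, Matrix.col_apply, upperPart_apply]
  change _ + (if w.1 i = j ∧ i < j then (1 : ℂ) else 0) = _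
  have hinv : w.1 i = j ↔ i = w.1 j := by
    have := involutions_apply_apply (toInvolution w)
    constructor
    · rintro rfl; exact (this i).symm
    · rintro rfl; exact this j
  unfold arcVec
  by_cases hfix : w.1 j = j
  · rw [if_pos hfix, if_neg (by rw [hinv, hfix]; rintro ⟨rfl, h⟩; exact lt_irrefl _ h), add_zero]
    rfl
  · have hlt : w.1 j < j := by
      refine lt_of_le_of_ne (not_lt.1 fun hlt => ?_) hfix
      have := (hw j _ hlt rfl).1
      exact Finset.mem_compl.1 this (Finset.mem_union_left _ (mem_bitSet.2 hj))
    rw [if_neg hfix, Pi.add_apply, add_comm]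
    congr 1
    simp only [hinv]
    by_cases hi : i = w.1 j
    · subst hi; simp [hlt, stdVec]
    · simp [hi, stdVec]

theorem canonicalPair_eq (hlam : Fits k n lam) (hmu : Fits m n mu)
    (w : consistent k m n lam mu) : canonicalPair hlam hmu w =
      pairPoint (card_bitSet hlam) (card_bitSet hmu) (upperPart (toInvolution w)) := by
  refine Prod.ext ?_ (coordPoint_eq hmu)
  change _ = oneAdd (upperPart (toInvolution w)) • coordSpace (card_bitSet hlam)
  rw [← coordPoint_eq hlam]
  apply Subtype.ext
  change Submodule.span ℂ _ = (Submodule.span ℂ _).map _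
  rw [Submodule.map_span, Set.image_image]
  congr 1
  refine Set.image_congr fun j hj => ?_
  rw [Matrix.toLin'_apply, oneAdd_mulVec_stdVec w hj]

theorem pairOrbit_eq (hlam : Fits k n lam) (hmu : Fits m n mu) (w : consistent k m n lam mu) :
    pairOrbit hlam hmu w = MulAction.orbit (borel n)
      (pairPoint (card_bitSet hlam) (card_bitSet hmu) (upperPart (toInvolution w))) := by
  rw [pairOrbit, canonicalPair_eq]

theorem pairLE_iff_adjointLE (hlam : Fits k n lam) (hmu : Fits m n mu)
    (v w : consistent k m n lam mu) :
    pairLE hlam hmu v w ↔ adjointLE (toInvolution v) (toInvolution w) := by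
  rw [pairLE, pairOrbit_eq, pairOrbit_eq]
  constructor
  · intro h
    exact adjointLE_of_mem_closure _ _ (arcsIn_toInvolution v) (arcsIn_toInvolution w)
      (h (MulAction.mem_orbit_self _))
  · intro h
    exact orbit_subset_closure_of_mem_closure _ _ (arcsIn_toInvolution v) (arcsIn_toInvolution w)
      (h (upperPart_mem_adjointOrbit _))

theorem toInvolution_injective :
    Function.Injective (toInvolution : consistent k m n lam mu → involutions n) :=
  fun _ _ h => Subtype.ext (congrArg (fun x : involutions n => x.1) h)

/-! ### The parametrisation of orbits and the order axioms -/

theorem bijOn_pairOrbit (hlam : Fits k n lam) (hmu : Fits m n mu) :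
    Set.BijOn (pairOrbit hlam hmu) Set.univ
      {O : Set (Gr k n × Gr m n) | (∃ x, O = MulAction.orbit (borel n) x) ∧
        O ⊆ schubertCell hlam ×ˢ schubertCell hmu} := by
  have hpl := coordPoint_eq hlam
  have hpm := coordPoint_eq hmu
  refine ⟨fun w _ => ⟨⟨_, rfl⟩, ?_⟩, fun v _ w _ h => ?_, ?_⟩
  · rw [pairOrbit_eq]
    rintro _ ⟨⟨g, hg⟩, rfl⟩
    constructor
    · refine ⟨⟨g * oneAdd (upperPart (toInvolution w)), mul_mem hg (oneAdd_mem_borel _)⟩, ?_⟩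
      change (g * oneAdd _) • coordPoint hlam = g • oneAdd _ • coordSpace _
      rw [hpl, mul_smul]
    · refine ⟨⟨g, hg⟩, ?_⟩
      change g • coordPoint hmu = g • coordSpace _
      rw [hpm]
  · rw [pairOrbit_eq, pairOrbit_eq] at h
    exact toInvolution_injective (eq_of_mem_orbit _ _ (arcsIn_toInvolution v)
      (arcsIn_toInvolution w) (MulAction.orbit_eq_iff.1 h))
  · rintro _ ⟨⟨x, rfl⟩, hO⟩
    obtain ⟨⟨⟨b, hb⟩, hbx⟩, ⟨⟨c, hc⟩, hcx⟩⟩ := hO (MulAction.mem_orbit_self x)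
    have hx : x = (b • coordSpace (card_bitSet hlam), c • coordSpace (card_bitSet hmu)) :=
      Prod.ext (hpl ▸ hbx.symm) (hpm ▸ hcx.symm)
    obtain ⟨w, hw, horb⟩ := exists_involution_of_smul (card_bitSet hlam) (card_bitSet hmu) hb hc
    refine ⟨⟨w.1, mem_consistent_iff.2 hw⟩, trivial, ?_⟩
    rw [pairOrbit_eq, hx]
    exact (MulAction.orbit_eq_iff.2 horb).symm

theorem subset_closure_trans {X : Type*} [TopologicalSpace X] {A B C : Set X}
    (h1 : A ⊆ closure B) (h2 : B ⊆ closure C) : A ⊆ closure C :=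
  h1.trans (closure_minimal h2 isClosed_closure)

theorem isPartialOrder_adjointLE (n : ℕ) : IsPartialOrder (involutions n) adjointLE where
  refl _ := subset_closure
  trans _ _ _ h1 h2 := subset_closure_trans h1 h2
  antisymm _ _ h1 h2 := adjointLE_antisymm h1 h2

theorem isPartialOrder_pairLE (hlam : Fits k n lam) (hmu : Fits m n mu) :
    IsPartialOrder (consistent k m n lam mu) (pairLE hlam hmu) where
  refl _ := @subset_closure _ (grTopology k m n) _
  trans _ _ _ h1 h2 := @subset_closure_trans _ (grTopology k m n) _ _ _ h1 h2
  antisymm v w h1 h2 := toInvolution_injective (adjointLE_antisymm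
    ((pairLE_iff_adjointLE hlam hmu v w).1 h1) ((pairLE_iff_adjointLE hlam hmu w v).1 h2))

end Consistent

end DoubleGrassmannian

end

theorem mainTheorem1 (k m n : ℕ) (lam mu : YoungDiagram)
    (hlam : DoubleGrassmannian.Fits k n lam) (hmu : DoubleGrassmannian.Fits m n mu) :
    -- the orbits inside the product of Schubert cells are indexed by consistent involutions
    Set.BijOn (DoubleGrassmannian.pairOrbit hlam hmu) Set.univ
      {O : Set (DoubleGrassmannian.Gr k n × DoubleGrassmannian.Gr m n) |
        (∃ x, O = MulAction.orbit (DoubleGrassmannian.borel n) x) ∧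
        O ⊆ DoubleGrassmannian.schubertCell hlam ×ˢ DoubleGrassmannian.schubertCell hmu} ∧
    -- both relations are partial orders
    IsPartialOrder (DoubleGrassmannian.involutions n) DoubleGrassmannian.adjointLE ∧
    IsPartialOrder (DoubleGrassmannian.consistent k m n lam mu)
      (DoubleGrassmannian.pairLE hlam hmu) ∧
    -- the second is the restriction of the first
    ∀ v w : DoubleGrassmannian.consistent k m n lam mu,
      DoubleGrassmannian.pairLE hlam hmu v w ↔
        DoubleGrassmannian.adjointLE (DoubleGrassmannian.toInvolution v)
          (DoubleGrassmannian.toInvolution w) :=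
  ⟨DoubleGrassmannian.bijOn_pairOrbit hlam hmu, DoubleGrassmannian.isPartialOrder_adjointLE n,
    DoubleGrassmannian.isPartialOrder_pairLE hlam hmu,
    DoubleGrassmannian.pairLE_iff_adjointLE hlam hmu⟩
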